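/- Let $\mathbb{T}^2=(\mathbb{R}/2\pi\mathbb{Z})^2$ be the flat torus with Lebesgue measure, let $1<p\le\infty$ and $K>0$, and let $\mathcal{F}\subset H^1(\mathbb{T}^2)$ be a family of real-valued mean-free functions. Assume that every $f\in\mathcal{F}$ can be written as $f=\mu+w$, where $\mu\ge 0$ is a finite Borel measure belonging to $H^{-1}(\mathbb{T}^2)$, $w\in L^p(\mathbb{T}^2)$, and $$\|\mu\|_{\mathcal{BM}}+\|\mu\|_{H^{-1}}+\|w\|_{L^p}\le K.$$ Here $\|\mu\|_{\mathcal{BM}}$ is the total variation (that is, $\mu(\mathbb{T}^2)$), and $\|\mu\|_{H^{-1}}=\sup\{|\int\varphi\,d\mu| : \varphi\in C^\infty(\mathbb{T}^2),\ \|\varphi\|_{L^2}^2+\|\nabla\varphi\|_{L^2}^2\le 1\}$. Then there exists a $C^1$ function $\Phi:[0,\infty)\to[0,\infty)$ which is concave, strictly increasing, a bijection of $[0,\infty)$ onto itself, sublinear, i.e. $\Phi(x)/x\to 0$ as $x\to\infty$, and satisfies $\Phi(x)=\mathcal{O}\left(x|\log x|^{-1/4}\right)$ as $x\to\infty$, such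 that $\Upsilon=(\Phi^{-1})^2$ satisfies $$\Upsilon\left(\|f\|_{L^2}^2\right)\le\|\nabla f\|_{L^2}^2\qquad\text{for all } f\in\mathcal{F}.$$ -/

import Mathlib

open MeasureTheory Set Filter Asymptotics
open scoped ENNReal ContDiff

noncomputable section

namespace TorusNash

instance fact_two_pi_pos : Fact (0 < 2 * Real.pi) := ⟨Real.two_pi_pos⟩

/-- The flat torus `𝕋² = (ℝ / 2πℤ)²`, i.e. `[-π, π]²` with opposite sides identified.
Its `volume` is Lebesgue measure, of total mass `(2π)²`. -/
abbrev T2 : Type := Fin 2 → AddCircle (2 * Real.pi)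

/-- The covering map `ℝ² → 𝕋²`. -/
def cover (x : Fin 2 → ℝ) : T2 := fun i => (x i : AddCircle (2 * Real.pi))

/-- `φ ∈ C^∞(𝕋²)`: the periodic lift of `φ` to `ℝ²` is smooth. -/
def IsSmooth (φ : T2 → ℝ) : Prop := ContDiff ℝ ∞ (fun x : Fin 2 → ℝ => φ (cover x))

/-- The classical partial derivative `∂ᵢ φ` on the torus. -/
def pderiv (i : Fin 2) (φ : T2 → ℝ) (x : T2) : ℝ :=
  deriv (fun t : ℝ => φ (x + Pi.single i (t : AddCircle (2 * Real.pi)))) 0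

/-- `G` is the weak gradient of `f`: `∫ f ∂ᵢφ = - ∫ Gᵢ φ` for all `φ ∈ C^∞(𝕋²)` and `i = 1, 2`. -/
def IsWeakGradient (f : T2 → ℝ) (G : T2 → EuclideanSpace ℝ (Fin 2)) : Prop :=
  ∀ φ : T2 → ℝ, IsSmooth φ → ∀ i : Fin 2,
    ∫ x, f x * pderiv i φ x = - ∫ x, G x i * φ x

/-- `f ∈ H¹(𝕋²)` with weak gradient `∇f = G`: both `f` and `G` are in `L²`. -/
structure MemH1With (f : T2 → ℝ) (G : T2 → EuclideanSpace ℝ (Fin 2)) : Prop where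
  memLp : MemLp f 2 volume
  memLp_grad : MemLp G 2 volume
  weakGradient : IsWeakGradient f G

/-- The `H¹` norm of a smooth function. -/
def smoothH1Norm (φ : T2 → ℝ) : ℝ :=
  Real.sqrt ((∫ x, φ x ^ 2) + ∑ i : Fin 2, ∫ x, pderiv i φ x ^ 2)

/-- The `H⁻¹(𝕋²)` norm of a finite measure, as the norm dual to `H¹` (smooth functions being
dense in `H¹`); it is `∞` exactly when the measure does not belong to `H⁻¹`. -/
def hMinusOneNorm (μ : Measure T2) : ℝ≥0∞ :=
  ⨆ (φ : T2 → ℝ) (_ : IsSmooth φ) (_ : smoothH1Norm φ ≤ 1), ENNReal.ofReal |∫ x, φ x ∂μ|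

/-- `f = μ + w` (as signed measures) with `μ ≥ 0` a finite Borel measure in `H⁻¹`, `w ∈ L^p`, and
`‖μ‖_{BM} + ‖μ‖_{H⁻¹} + ‖w‖_{L^p} ≤ K`. The total variation norm of `μ ≥ 0` is its mass. -/
def HasDecomposition (p : ℝ≥0∞) (K : ℝ) (f : T2 → ℝ) : Prop :=
  ∃ (μ : Measure T2) (_ : IsFiniteMeasure μ) (w : T2 → ℝ),
    MemLp w p volume ∧
    (volume : Measure T2).withDensityᵥ f
      = μ.toSignedMeasure + (volume : Measure T2).withDensityᵥ w ∧
    μ univ + hMinusOneNorm μ + eLpNorm w p volume ≤ ENNReal.ofReal K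

/-- `Υ = (Φ⁻¹)²`, where `Φ⁻¹` is the inverse of `Φ` as a function on `[0, ∞)`. -/
def upsilon (Φ : ℝ → ℝ) (y : ℝ) : ℝ := (Function.invFunOn Φ (Ici 0) y) ^ 2

end TorusNash

end

namespace TorusNash

/-! ### Smooth functions on the torus -/

/-! Write `n = ‖f‖_{L²}`, `d = ‖∇f‖_{L²}`. The claim reduces to `n² ≤ Φ(d)` with `Φ(x) = A x log(e²
+ x)^(-1/4)`. This is a Nash-type inequality improved by a logarithm, and the gain comes from the
decay of the mass of `f` on small balls.

Local mass. A smooth logarithm truncated at scale `r` is at least `2|log r|` on a ball of radius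
`r`, while its `H¹` norm is `O(√|log r|)`. Duality with `H⁻¹` and Markov's inequality give `μ(B_r) =
O(|log r|^(-1/2))` (`measureReal_closedBall_le`). Hölder gives a power of `r` for `w`, which is
smaller. Since `f - w ≥ 0`, the same bound holds for `|f|` (`exists_local_mass_bound`).

Averaging. The correlation `∫ f(x) f(x+s) dx` is at least `n² - (|s₀| + |s₁|) n d`. Averaged over
`s` in a ball of radius `r`, it is at most `‖f‖_{L¹}` times the largest mass of `|f|` on such a
ball, divided by `4r²`. Hence `n² ≤ 4r²d² + O(r⁻² |log r|^(-1/2))`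
(`MemH1With.integral_sq_le_of_ball`).

For `d ≥ 1` the two terms balance at `r² ≈ log(e² + d)^(-1/4) / d`, and each is then `O(Φ(d))`. For
`d ≤ 1`, Poincaré's inequality suffices, because `Φ` is linear from below there. -/

lemma isOpenQuotientMap_cover : IsOpenQuotientMap cover :=
  IsOpenQuotientMap.piMap (f := fun (_ : Fin 2) (t : ℝ) => (t : AddCircle (2 * Real.pi)))
    fun _ => QuotientAddGroup.isOpenQuotientMap_mk

lemma cover_add (x y : Fin 2 → ℝ) : cover (x + y) = cover x + cover y := by
  ext i; simp [cover]

lemma cover_single (i : Fin 2) (t : ℝ) :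
    cover (Pi.single i t) = Pi.single i (t : AddCircle (2 * Real.pi)) := by
  ext j
  by_cases h : j = i
  · subst h; simp [cover]
  · simp [cover, h]

namespace IsSmooth

variable {φ ψ : T2 → ℝ}

lemma continuous (hφ : IsSmooth φ) : Continuous φ :=
  isOpenQuotientMap_cover.isQuotientMap.continuous_iff.2 (ContDiff.continuous hφ)

lemma exists_norm_le (hφ : IsSmooth φ) : ∃ C, ∀ x, ‖φ x‖ ≤ C := by
  obtain ⟨C, hC⟩ := isCompact_univ.exists_bound_of_continuousOn hφ.continuous.continuousOn
  exact ⟨C, fun x => hC x (mem_univ x)⟩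

lemma memLp (hφ : IsSmooth φ) (p : ℝ≥0∞) : MemLp φ p volume := by
  obtain ⟨C, hC⟩ := hφ.exists_norm_le
  exact MemLp.of_bound hφ.continuous.aestronglyMeasurable C (.of_forall hC)

lemma add (hφ : IsSmooth φ) (hψ : IsSmooth ψ) : IsSmooth (φ + ψ) := ContDiff.add hφ hψ

lemma mul (hφ : IsSmooth φ) (hψ : IsSmooth ψ) : IsSmooth (φ * ψ) := ContDiff.mul hφ hψ

lemma const (c : ℝ) : IsSmooth fun _ => c := contDiff_const

lemma comp_add_right (hφ : IsSmooth φ) (s : T2) : IsSmooth fun x => φ (x + s) := by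
  obtain ⟨a, rfl⟩ := isOpenQuotientMap_cover.surjective s
  simp only [IsSmooth, ← cover_add]
  exact ContDiff.comp (g := fun x => φ (cover x)) hφ (contDiff_id.add contDiff_const)

lemma hasDerivAt (hφ : IsSmooth φ) (i : Fin 2) (x : T2) (t : ℝ) :
    HasDerivAt (fun t : ℝ => φ (x + Pi.single i (t : AddCircle (2 * Real.pi))))
      (pderiv i φ (x + Pi.single i (t : AddCircle (2 * Real.pi)))) t := by
  have key : ∀ (x : T2) (t : ℝ), DifferentiableAt ℝ
      (fun t : ℝ => φ (x + Pi.single i (t : AddCircle (2 * Real.pi)))) t := by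
    intro x t
    obtain ⟨a, rfl⟩ := isOpenQuotientMap_cover.surjective x
    simp only [← cover_single, ← cover_add]
    have h1 : Differentiable ℝ fun x => φ (cover x) := ContDiff.differentiable hφ (by simp)
    have h2 : Differentiable ℝ fun t : ℝ => a + Pi.single i t :=
      (differentiable_const a).add (ContinuousLinearMap.single ℝ (fun _ : Fin 2 => ℝ) i).differentiable
    exact (h1.comp h2) t
  -- `pderiv` differentiates at parameter `0` only; the base point is moved to `x + t eᵢ` and the
  -- line reparametrized by `u ↦ u - t`.
  have h := (key (x + Pi.single i (t : AddCircle (2 * Real.pi))) 0).hasDerivAt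
  have h3 : HasDerivAt (fun u : ℝ => u - t) 1 t := (hasDerivAt_id t).sub_const t
  have h4 := HasDerivAt.comp (h := fun u : ℝ => u - t) t (by rw [sub_self]; exact h) h3
  rw [mul_one] at h4
  have h5 : (fun t : ℝ => φ (x + Pi.single i (t : AddCircle (2 * Real.pi)))) =
      (fun u : ℝ => φ (x + Pi.single i (t : AddCircle (2 * Real.pi)) +
        Pi.single i (u : AddCircle (2 * Real.pi)))) ∘ fun u : ℝ => u - t := by
    ext u
    simp [add_assoc, ← Pi.single_add]
  rw [h5]
  exact h4

/-- Expressing `pderiv` through the Fréchet derivative of the lift makes it smooth again. -/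
lemma pderiv_cover (hφ : IsSmooth φ) (i : Fin 2) (a : Fin 2 → ℝ) :
    pderiv i φ (cover a) = fderiv ℝ (fun x => φ (cover x)) a (Pi.single i 1) := by
  have h1 : HasFDerivAt (fun x => φ (cover x)) (fderiv ℝ (fun x => φ (cover x)) a)
      (a + Pi.single i (0 : ℝ)) := by
    simpa using (ContDiff.differentiable hφ (by simp) a).hasFDerivAt
  have h2 : HasDerivAt (fun t : ℝ => a + Pi.single i t) (Pi.single i 1) 0 := by
    have := ((ContinuousLinearMap.single ℝ (fun _ : Fin 2 => ℝ) i).hasDerivAt (x := 0)).const_add a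
    simpa using this
  have h3 := h1.comp_hasDerivAt (0 : ℝ) h2
  rw [← h3.deriv]
  simp only [pderiv, Function.comp_def, cover_add, cover_single]

protected lemma pderiv (hφ : IsSmooth φ) (i : Fin 2) : IsSmooth (pderiv i φ) := by
  simp only [IsSmooth, hφ.pderiv_cover i]
  exact (ContDiff.fderiv_right hφ (m := ∞) (by simp)).clm_apply contDiff_const

end IsSmooth

lemma pderiv_comp_add_right (i : Fin 2) (φ : T2 → ℝ) (s x : T2) :
    pderiv i (fun y => φ (y + s)) x = pderiv i φ (x + s) := by
  simp only [pderiv, add_right_comm]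

/-- The smooth functions as a subalgebra of the continuous functions. -/
def smoothSubalgebra : Subalgebra ℝ C(T2, ℝ) where
  carrier := {φ | IsSmooth φ}
  mul_mem' ha hb := IsSmooth.mul ha hb
  add_mem' ha hb := IsSmooth.add ha hb
  algebraMap_mem' c := IsSmooth.const c

/-- The cosine of the `i`-th coordinate. -/
noncomputable def cosCoord (i : Fin 2) (x : T2) : ℝ := Real.cos_periodic.lift (x i)

/-- The sine of the `i`-th coordinate. -/
noncomputable def sinCoord (i : Fin 2) (x : T2) : ℝ := Real.sin_periodic.lift (x i)

lemma cosCoord_cover (i : Fin 2) (a : Fin 2 → ℝ) : cosCoord i (cover a) = Real.cos (a i) := rfl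

lemma sinCoord_cover (i : Fin 2) (a : Fin 2 → ℝ) : sinCoord i (cover a) = Real.sin (a i) := rfl

lemma isSmooth_cosCoord (i : Fin 2) : IsSmooth (cosCoord i) := by
  simp only [IsSmooth, cosCoord_cover]
  exact Real.contDiff_cos.comp (contDiff_apply ℝ ℝ i)

lemma isSmooth_sinCoord (i : Fin 2) : IsSmooth (sinCoord i) := by
  simp only [IsSmooth, sinCoord_cover]
  exact Real.contDiff_sin.comp (contDiff_apply ℝ ℝ i)

lemma smoothSubalgebra_separatesPoints : smoothSubalgebra.SeparatesPoints := by
  intro x y hxy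
  obtain ⟨a, rfl⟩ := isOpenQuotientMap_cover.surjective x
  obtain ⟨b, rfl⟩ := isOpenQuotientMap_cover.surjective y
  obtain ⟨i, hi⟩ := Function.ne_iff.1 hxy
  by_contra! h
  have hc := h (cosCoord i)
    ⟨⟨cosCoord i, (isSmooth_cosCoord i).continuous⟩, isSmooth_cosCoord i, rfl⟩
  have hs := h (sinCoord i)
    ⟨⟨sinCoord i, (isSmooth_sinCoord i).continuous⟩, isSmooth_sinCoord i, rfl⟩
  simp only [cosCoord_cover, sinCoord_cover] at hc hs
  exact hi (Real.Angle.cos_sin_inj hc hs)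

/-- Smooth functions are dense in `L²`. -/
lemma dense_smooth : Dense {u : Lp ℝ 2 (volume : Measure T2) | ∃ φ, IsSmooth φ ∧ u =ᵐ[volume] φ} := by
  have h1 : Dense (smoothSubalgebra : Set C(T2, ℝ)) := by
    have := ContinuousMap.subalgebra_topologicalClosure_eq_top_of_separatesPoints _
      smoothSubalgebra_separatesPoints
    rw [dense_iff_closure_eq, ← Subalgebra.topologicalClosure_coe, this]
    rfl
  have h2 := (ContinuousMap.toLp_denseRange ℝ (volume : Measure T2) ℝ
    (p := 2) (by simp)).dense_image (ContinuousMap.toLp 2 (volume : Measure T2) ℝ).continuous h1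
  refine h2.mono ?_
  rintro _ ⟨φ, hφ, rfl⟩
  exact ⟨φ, hφ, ContinuousMap.coeFn_toLp _ _⟩

/-- An `L²` function whose pairings with smooth functions are bounded by `c` times their `L²` norm
has norm at most `c`. -/
lemma norm_le_of_forall_smooth (u : Lp ℝ 2 (volume : Measure T2)) {c : ℝ} (hc : 0 ≤ c)
    (h : ∀ v : Lp ℝ 2 (volume : Measure T2), ∀ φ, IsSmooth φ → v =ᵐ[volume] φ →
      |∫ x, u x * φ x| ≤ c * ‖v‖) : ‖u‖ ≤ c := by
  have key : ∀ v : Lp ℝ 2 (volume : Measure T2), |inner ℝ u v| ≤ c * ‖v‖ := by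
    have hcl : IsClosed {v : Lp ℝ 2 (volume : Measure T2) | |inner ℝ u v| ≤ c * ‖v‖} :=
      isClosed_le (by fun_prop) (by fun_prop)
    have hs : {v : Lp ℝ 2 (volume : Measure T2) | ∃ φ, IsSmooth φ ∧ v =ᵐ[volume] φ} ⊆
        {v : Lp ℝ 2 (volume : Measure T2) | |inner ℝ u v| ≤ c * ‖v‖} := by
      rintro v ⟨φ, hφ, hv⟩
      have := h v φ hφ hv
      rw [mem_ofPred_eq, L2.inner_def]
      convert this using 2
      refine integral_congr_ae ?_
      filter_upwards [hv] with x hx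
      simp [hx, mul_comm]
    intro v
    have := hcl.closure_subset_iff.2 hs (dense_smooth v)
    exact this
  have h1 := key u
  rw [real_inner_self_eq_norm_sq, abs_of_nonneg (sq_nonneg _), sq] at h1
  rcases (norm_nonneg u).eq_or_lt with h0 | h0
  · rw [← h0]; exact hc
  · exact le_of_mul_le_mul_right h1 h0

end TorusNash

namespace TorusNash

/-! ### Translation of `H¹` functions -/

lemma abs_integral_mul_le_eLpNorm_two {α : Type*} {m : MeasurableSpace α} {ν : Measure α}
    {g h : α → ℝ} (hg : MemLp g 2 ν) (hh : MemLp h 2 ν) :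
    |∫ x, g x * h x ∂ν| ≤ (eLpNorm g 2 ν).toReal * (eLpNorm h 2 ν).toReal := by
  have := abs_real_inner_le_norm (hg.toLp g) (hh.toLp h)
  rw [L2.inner_def, Lp.norm_toLp, Lp.norm_toLp] at this
  convert this using 2
  refine integral_congr_ae ?_
  filter_upwards [hg.coeFn_toLp, hh.coeFn_toLp] with x h1 h2
  simp [h1, h2, mul_comm]

lemma eLpNorm_comp_add_right {g : T2 → ℝ} {p : ℝ≥0∞} (hg : AEStronglyMeasurable g volume) (s : T2) :
    eLpNorm (fun x => g (x + s)) p volume = eLpNorm g p volume :=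
  eLpNorm_comp_measurePreserving hg (measurePreserving_add_right volume s)

lemma memLp_comp_add_right {g : T2 → ℝ} {p : ℝ≥0∞} (hg : MemLp g p volume) (s : T2) :
    MemLp (fun x => g (x + s)) p volume :=
  hg.comp_measurePreserving (measurePreserving_add_right volume s)

lemma hasDerivAt_integral_of_dominated {α : Type*} {m : MeasurableSpace α} {ν : Measure α}
    {F F' : ℝ → α → ℝ} {bound : α → ℝ} {t : ℝ}
    (hF : ∀ᶠ u in nhds t, AEStronglyMeasurable (F u) ν) (hi : Integrable (F t) ν)
    (hF' : AEStronglyMeasurable (F' t) ν)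
    (hb : ∀ᵐ x ∂ν, ∀ u ∈ (univ : Set ℝ), ‖F' u x‖ ≤ bound x) (hbound : Integrable bound ν)
    (hd : ∀ᵐ x ∂ν, ∀ u ∈ (univ : Set ℝ), HasDerivAt (fun u => F u x) (F' u x) u) :
    HasDerivAt (fun u => ∫ x, F u x ∂ν) (∫ x, F' t x ∂ν) t :=
  (hasDerivAt_integral_of_dominated_loc_of_deriv_le univ_mem hF hi hF' hb hbound hd).2

variable {f : T2 → ℝ} {G : T2 → EuclideanSpace ℝ (Fin 2)}

lemma MemH1With.memLp_coord (h : MemH1With f G) (i : Fin 2) :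
    MemLp (fun x => G x i) 2 volume := by
  refine h.memLp_grad.of_le ?_ (.of_forall fun x => PiLp.norm_apply_le (G x) i)
  exact (EuclideanSpace.proj (𝕜 := ℝ) i).continuous.comp_aestronglyMeasurable
    h.memLp_grad.aestronglyMeasurable

lemma MemH1With.eLpNorm_coord_le (i : Fin 2) :
    eLpNorm (fun x => G x i) 2 volume ≤ eLpNorm G 2 volume :=
  eLpNorm_mono fun x => PiLp.norm_apply_le (G x) i

/-- Differentiation under the integral falls on `φ`, and the weak gradient identity, tested with the
translate of `φ`, moves it to `G`. -/
lemma MemH1With.hasDerivAt_integral (h : MemH1With f G) {φ : T2 → ℝ} (hφ : IsSmooth φ)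
    (i : Fin 2) (t : ℝ) :
    HasDerivAt (fun t : ℝ => ∫ x, f x * φ (x + Pi.single i (t : AddCircle (2 * Real.pi))))
      (-∫ x, G x i * φ (x + Pi.single i (t : AddCircle (2 * Real.pi)))) t := by
  have hw := h.weakGradient _ (hφ.comp_add_right (Pi.single i (t : AddCircle (2 * Real.pi)))) i
  rw [← hw]
  simp only [pderiv_comp_add_right]
  have hd := hφ.hasDerivAt i
  obtain ⟨C, hC⟩ := (hφ.pderiv i).exists_norm_le
  have hφ' := hφ.pderiv i
  clear hw
  generalize pderiv i φ = φ' at *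
  obtain ⟨e, he⟩ : ∃ e : ℝ → T2, ∀ t : ℝ, e t = Pi.single i (t : AddCircle (2 * Real.pi)) :=
    ⟨_, fun _ => rfl⟩
  simp only [← he] at hd ⊢
  have hf : Integrable f volume := h.memLp.integrable (by norm_num)
  have hm : ∀ {ψ : T2 → ℝ}, IsSmooth ψ → ∀ s : T2,
      AEStronglyMeasurable (fun x => f x * ψ (x + s)) volume := fun hψ s =>
    hf.aestronglyMeasurable.mul (hψ.comp_add_right s).continuous.aestronglyMeasurable
  refine hasDerivAt_integral_of_dominated (F := fun (t : ℝ) x => f x * φ (x + e t))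
    (F' := fun (t : ℝ) x => f x * φ' (x + e t)) (bound := fun x => ‖f x‖ * C)
    (.of_forall fun u => hm hφ (e u)) ?_ (hm hφ' (e t)) ?_ (hf.norm.mul_const C) ?_
  · exact h.memLp.integrable_mul ((hφ.comp_add_right _).memLp 2)
  · refine .of_forall fun x t _ => ?_
    rw [norm_mul]
    exact mul_le_mul_of_nonneg_left (hC _) (norm_nonneg _)
  · exact .of_forall fun x t _ => (hd x t).const_mul (f x)

/-- By duality: pairing the difference with smooth `φ` gives `F(-t) - F(0)` for `F(τ) = ∫ f φ(· +
τeᵢ)`. Cauchy–Schwarz gives `|F'| ≤ ‖G‖ ‖φ‖`, and the mean value inequality concludes, with no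
approximation of `f` by smooth functions. -/
lemma MemH1With.eLpNorm_translate_single_le (h : MemH1With f G) (i : Fin 2) (t : ℝ) :
    eLpNorm (fun x => f (x + Pi.single i (t : AddCircle (2 * Real.pi))) - f x) 2 volume ≤
      ENNReal.ofReal |t| * eLpNorm G 2 volume := by
  set e : ℝ → T2 := fun t => Pi.single i (t : AddCircle (2 * Real.pi)) with he
  have hmem : MemLp (fun x => f (x + e t) - f x) 2 volume :=
    (memLp_comp_add_right h.memLp _).sub h.memLp
  have hfin := h.memLp_grad.eLpNorm_ne_top
  suffices hs : ‖hmem.toLp _‖ ≤ |t| * (eLpNorm G 2 volume).toReal by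
    rw [Lp.norm_toLp] at hs
    rw [← ENNReal.ofReal_toReal hmem.eLpNorm_ne_top]
    refine (ENNReal.ofReal_le_ofReal hs).trans ?_
    rw [ENNReal.ofReal_mul (abs_nonneg _), ENNReal.ofReal_toReal hfin]
  refine norm_le_of_forall_smooth _ (by positivity) fun v φ hφ hv => ?_
  have hnv : ‖v‖ = (eLpNorm φ 2 volume).toReal := by
    rw [Lp.norm_def, eLpNorm_congr_ae hv]
  have hφm := hφ.memLp 2
  have h1 : ∫ x, hmem.toLp _ x * φ x = (∫ x, f x * φ (x + e (-t))) - ∫ x, f x * φ (x + e 0) := by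
    have hi : Integrable (fun x => f (x + e t) * φ x) volume :=
      (memLp_comp_add_right h.memLp _).integrable_mul hφm
    have h2 : ∫ x, f (x + e t) * φ x = ∫ x, f x * φ (x + e (-t)) := by
      rw [← integral_add_right_eq_self (fun x => f x * φ (x + e (-t))) (e t)]
      refine integral_congr_ae (.of_forall fun x => ?_)
      simp [he, add_assoc, ← Pi.single_add]
    have hi0 : Integrable (fun x => f x * φ (x + e 0)) volume :=
      h.memLp.integrable_mul ((hφ.comp_add_right _).memLp 2)
    rw [← h2, ← integral_sub hi hi0]
    refine integral_congr_ae ?_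
    filter_upwards [hmem.coeFn_toLp] with x hx
    rw [hx]
    simp [he, sub_mul]
  rw [h1]
  have hb : ∀ τ ∈ (univ : Set ℝ), ‖-∫ x, G x i * φ (x + e τ)‖ ≤
      (eLpNorm G 2 volume).toReal * ‖v‖ := by
    intro τ _
    rw [norm_neg, Real.norm_eq_abs, hnv]
    refine (abs_integral_mul_le_eLpNorm_two (h.memLp_coord i)
      ((hφ.comp_add_right _).memLp 2)).trans ?_
    rw [eLpNorm_comp_add_right hφ.continuous.aestronglyMeasurable]
    gcongr
    exact (eLpNorm_coord_le i)
  have := Convex.norm_image_sub_le_of_norm_hasDerivWithin_le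
    (fun τ _ => (h.hasDerivAt_integral hφ i τ).hasDerivWithinAt) hb convex_univ
    (mem_univ 0) (mem_univ (-t))
  rw [sub_zero, norm_neg, Real.norm_eq_abs, Real.norm_eq_abs] at this
  linarith

lemma exists_coe_eq_abs_eq_norm (s : AddCircle (2 * Real.pi)) :
    ∃ t : ℝ, (t : AddCircle (2 * Real.pi)) = s ∧ |t| = ‖s‖ := by
  obtain ⟨t, rfl⟩ := QuotientAddGroup.mk_surjective s
  refine ⟨t - round ((2 * Real.pi)⁻¹ * t) * (2 * Real.pi), ?_, (AddCircle.norm_eq _).symm⟩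
  rw [AddCircle.coe_sub, ← zsmul_eq_mul, AddCircle.coe_zsmul, AddCircle.coe_period]
  simp

/-- `‖f(· + s) - f‖_{L²} ≤ (|s₀| + |s₁|) ‖∇f‖_{L²}`. -/
lemma MemH1With.eLpNorm_translate_le (h : MemH1With f G) (s : T2) :
    eLpNorm (fun x => f (x + s) - f x) 2 volume ≤
      ENNReal.ofReal (‖s 0‖ + ‖s 1‖) * eLpNorm G 2 volume := by
  obtain ⟨a, ha, hna⟩ := exists_coe_eq_abs_eq_norm (s 0)
  obtain ⟨b, hb, hnb⟩ := exists_coe_eq_abs_eq_norm (s 1)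
  have hs : s = Pi.single 1 (b : AddCircle (2 * Real.pi)) +
      Pi.single 0 (a : AddCircle (2 * Real.pi)) := by
    ext i; fin_cases i <;> simp [ha, hb]
  have hsm : ∀ c : T2, AEStronglyMeasurable (fun x => f (x + c) - f x) volume := fun c =>
    ((memLp_comp_add_right h.memLp _).sub h.memLp).aestronglyMeasurable
  rw [ENNReal.ofReal_add (norm_nonneg _) (norm_nonneg _), add_mul, ← hna, ← hnb]
  have h1 : (fun x => f (x + s) - f x) =
      (fun x => (fun y => f (y + Pi.single 0 (a : AddCircle (2 * Real.pi))) - f y)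
        (x + Pi.single 1 (b : AddCircle (2 * Real.pi)))) +
      fun x => f (x + Pi.single 1 (b : AddCircle (2 * Real.pi))) - f x := by
    ext x
    simp [hs, add_assoc]
  rw [h1]
  refine (eLpNorm_add_le
    ((hsm _).comp_measurePreserving (measurePreserving_add_right volume _)) (hsm _)
    (by norm_num)).trans ?_
  rw [eLpNorm_comp_measurePreserving (hsm _) (measurePreserving_add_right volume _)]
  exact add_le_add (h.eLpNorm_translate_single_le 0 a) (h.eLpNorm_translate_single_le 1 b)

end TorusNash

namespace TorusNash

/-! ### A logarithmic test function and the mass of small balls -/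

lemma sq_div_nine_le_one_sub_cos {b : ℝ} (hb : |b| ≤ Real.pi) : (b / 3) ^ 2 ≤ 1 - Real.cos b := by
  have h1 := Real.cos_le_one_sub_mul_cos_sq hb
  have h2 : (1 : ℝ) / 9 ≤ 2 / Real.pi ^ 2 := by
    rw [div_le_div_iff₀ (by norm_num) (by positivity)]
    nlinarith [Real.pi_lt_four, Real.pi_pos]
  nlinarith [mul_le_mul_of_nonneg_right h2 (sq_nonneg b)]

/-- Replacing `1 - cos b` by the smaller `(b/3)²` leaves an arctangent, whose total variation is at
most `π`. -/
lemma integral_inv_add_one_sub_cos_le {A : ℝ} (hA : 0 < A) :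
    ∫ b in (-Real.pi)..Real.pi, (A + (1 - Real.cos b))⁻¹ ≤ 3 * Real.pi / √A := by
  have hα : 0 < √A := Real.sqrt_pos.2 hA
  have hd : ∀ b : ℝ, HasDerivAt (fun b => 3 / √A * Real.arctan (b / (3 * √A)))
      ((A + (b / 3) ^ 2)⁻¹) b := by
    intro b
    have h := (((hasDerivAt_id b).div_const (3 * √A)).arctan).const_mul (3 / √A)
    refine h.congr_deriv ?_
    have hA2 : A + (b / 3) ^ 2 = √A ^ 2 + (b / 3) ^ 2 := by rw [Real.sq_sqrt hA.le]
    rw [hA2]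
    simp only [id]
    field_simp
  have hc : Continuous fun b : ℝ => (A + (b / 3) ^ 2)⁻¹ :=
    Continuous.inv₀ (by fun_prop) fun b => by positivity
  have hc' : Continuous fun b : ℝ => (A + (1 - Real.cos b))⁻¹ :=
    Continuous.inv₀ (by fun_prop) fun b => by linarith [Real.cos_le_one b]
  have hle : -Real.pi ≤ Real.pi := by linarith [Real.pi_pos]
  calc ∫ b in (-Real.pi)..Real.pi, (A + (1 - Real.cos b))⁻¹
      ≤ ∫ b in (-Real.pi)..Real.pi, (A + (b / 3) ^ 2)⁻¹ := by
        refine intervalIntegral.integral_mono_on hle (hc'.intervalIntegrable _ _)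
          (hc.intervalIntegrable _ _) fun b hb => ?_
        have := sq_div_nine_le_one_sub_cos (abs_le.2 hb)
        gcongr
    _ = 3 / √A * Real.arctan (Real.pi / (3 * √A)) - 3 / √A * Real.arctan (-Real.pi / (3 * √A)) :=
        intervalIntegral.integral_eq_sub_of_hasDerivAt (fun b _ => hd b)
          (hc.intervalIntegrable _ _)
    _ ≤ 3 * Real.pi / √A := by
        rw [← mul_sub, div_mul_eq_mul_div]
        have h1 := Real.arctan_lt_pi_div_two (Real.pi / (3 * √A))
        have h2 := Real.neg_pi_div_two_lt_arctan (-Real.pi / (3 * √A))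
        gcongr
        linarith

lemma arsinh_le_log {x : ℝ} (hx : 0 ≤ x) : Real.arsinh x ≤ Real.log (1 + 2 * x) := by
  rw [Real.arsinh]
  have : √(1 + x ^ 2) ≤ 1 + x := Real.sqrt_le_iff.2 ⟨by linarith, by nlinarith⟩
  exact Real.log_le_log (by positivity) (by linarith)

lemma integral_inv_sqrt_add_one_sub_cos_le {r : ℝ} (hr : 0 < r) (hr1 : r ≤ Real.exp (-1)) :
    ∫ a in (-Real.pi)..Real.pi, 3 * Real.pi / √(r ^ 2 + (1 - Real.cos a)) ≤
      54 * Real.pi * -Real.log r := by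
  have hd : ∀ a : ℝ, HasDerivAt (fun a => 9 * Real.pi * Real.arsinh (a / (3 * r)))
      (3 * Real.pi / √(r ^ 2 + (a / 3) ^ 2)) a := by
    intro a
    have h := (((hasDerivAt_id a).div_const (3 * r)).arsinh).const_mul (9 * Real.pi)
    refine h.congr_deriv ?_
    have : r ^ 2 + (a / 3) ^ 2 = r ^ 2 * (1 + (a / (3 * r)) ^ 2) := by field_simp
    rw [this, Real.sqrt_mul (sq_nonneg r), Real.sqrt_sq hr.le]
    have h3 : 0 < √(1 + (a / (3 * r)) ^ 2) := Real.sqrt_pos.2 (by positivity)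
    simp only [id, smul_eq_mul]
    field_simp
    norm_num
  have hc : Continuous fun a : ℝ => 3 * Real.pi / √(r ^ 2 + (a / 3) ^ 2) :=
    Continuous.div (by fun_prop) (by fun_prop) fun a => by positivity
  have hc' : Continuous fun a : ℝ => 3 * Real.pi / √(r ^ 2 + (1 - Real.cos a)) := by
    refine Continuous.div (by fun_prop) (by fun_prop) fun a => ?_
    have := Real.cos_le_one a
    exact (Real.sqrt_pos.2 (by nlinarith [sq_pos_of_pos hr])).ne'
  have hle : -Real.pi ≤ Real.pi := by linarith [Real.pi_pos]
  have hlog : Real.log r ≤ -1 := by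
    simpa using Real.log_le_log hr hr1
  calc ∫ a in (-Real.pi)..Real.pi, 3 * Real.pi / √(r ^ 2 + (1 - Real.cos a))
      ≤ ∫ a in (-Real.pi)..Real.pi, 3 * Real.pi / √(r ^ 2 + (a / 3) ^ 2) := by
        refine intervalIntegral.integral_mono_on hle (hc'.intervalIntegrable _ _)
          (hc.intervalIntegrable _ _) fun b hb => ?_
        have := sq_div_nine_le_one_sub_cos (abs_le.2 hb)
        gcongr
    _ = 9 * Real.pi * Real.arsinh (Real.pi / (3 * r)) -
          9 * Real.pi * Real.arsinh (-Real.pi / (3 * r)) :=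
        intervalIntegral.integral_eq_sub_of_hasDerivAt (fun b _ => hd b)
          (hc.intervalIntegrable _ _)
    _ = 18 * Real.pi * Real.arsinh (Real.pi / (3 * r)) := by
        rw [neg_div, Real.arsinh_neg]; ring
    _ ≤ 18 * Real.pi * (3 * -Real.log r) := by
        gcongr
        refine (arsinh_le_log (by positivity)).trans ?_
        -- After this, `log(e²/r) = 2 + |log r| ≤ 3|log r|`, because `|log r| ≥ 1`.
        have h1 : 1 + 2 * (Real.pi / (3 * r)) ≤ Real.exp 2 / r := by
          have h2 : r ≤ 1 := hr1.trans (Real.exp_le_one_iff.2 (by norm_num))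
          have h3 : (5 : ℝ) ≤ Real.exp 2 := by
            have : Real.exp 2 = Real.exp 1 * Real.exp 1 := by rw [← Real.exp_add]; norm_num
            nlinarith [Real.exp_one_gt_d9]
          have h4 : 1 + 2 * (Real.pi / (3 * r)) = (r + 2 * Real.pi / 3) / r := by field_simp
          rw [h4]
          gcongr
          linarith [Real.pi_lt_four]
        refine (Real.log_le_log (by positivity) h1).trans ?_
        rw [Real.log_div (Real.exp_pos _).ne' hr.ne', Real.log_exp]
        linarith
    _ = 54 * Real.pi * -Real.log r := by ring

/-- A smooth substitute for half the squared distance to the origin. -/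
noncomputable def cosDist (z : T2) : ℝ := (1 - cosCoord 0 z) + (1 - cosCoord 1 z)

lemma cosCoord_le_one (i : Fin 2) (z : T2) : cosCoord i z ≤ 1 := by
  obtain ⟨a, rfl⟩ := isOpenQuotientMap_cover.surjective z
  exact Real.cos_le_one _

lemma neg_one_le_cosCoord (i : Fin 2) (z : T2) : -1 ≤ cosCoord i z := by
  obtain ⟨a, rfl⟩ := isOpenQuotientMap_cover.surjective z
  exact Real.neg_one_le_cos _

lemma sinCoord_sq_add_cosCoord_sq (i : Fin 2) (z : T2) : sinCoord i z ^ 2 + cosCoord i z ^ 2 = 1 := by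
  obtain ⟨a, rfl⟩ := isOpenQuotientMap_cover.surjective z
  exact Real.sin_sq_add_cos_sq _

lemma cosDist_nonneg (z : T2) : 0 ≤ cosDist z := by
  rw [cosDist]; linarith [cosCoord_le_one 0 z, cosCoord_le_one 1 z]

lemma cosDist_le (z : T2) : cosDist z ≤ 4 := by
  rw [cosDist]; linarith [neg_one_le_cosCoord 0 z, neg_one_le_cosCoord 1 z]

lemma one_sub_cosCoord_le (i : Fin 2) (z : T2) : 1 - cosCoord i z ≤ ‖z i‖ ^ 2 / 2 := by
  obtain ⟨t, ht, hn⟩ := exists_coe_eq_abs_eq_norm (z i)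
  have h : cosCoord i z = Real.cos t := by rw [cosCoord, ← ht]; rfl
  rw [h, ← hn, sq_abs]
  linarith [Real.one_sub_sq_div_two_le_cos (x := t)]

lemma cosDist_le_sq {z : T2} {r : ℝ} (hz : ‖z‖ ≤ r) : cosDist z ≤ r ^ 2 := by
  have h : ∀ i, ‖z i‖ ^ 2 ≤ r ^ 2 := fun i =>
    pow_le_pow_left₀ (norm_nonneg _) ((norm_le_pi_norm z i).trans hz) 2
  rw [cosDist]
  linarith [one_sub_cosCoord_le 0 z, one_sub_cosCoord_le 1 z, h 0, h 1]

lemma isSmooth_cosDist : IsSmooth cosDist := by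
  have h := fun i => isSmooth_cosCoord i
  simp only [IsSmooth, cosDist] at h ⊢
  exact (contDiff_const.sub (h 0)).add (contDiff_const.sub (h 1))

lemma hasDerivAt_cosDist (i : Fin 2) (z : T2) :
    HasDerivAt (fun t : ℝ => cosDist (z + Pi.single i (t : AddCircle (2 * Real.pi))))
      (sinCoord i z) 0 := by
  have h : HasDerivAt (fun t : ℝ => cosCoord i (z + Pi.single i (t : AddCircle (2 * Real.pi))))
      (-sinCoord i z) 0 := by
    obtain ⟨a, rfl⟩ := isOpenQuotientMap_cover.surjective z
    simp only [← cover_single, ← cover_add, cosCoord_cover, sinCoord_cover]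
    have h1 : HasDerivAt (fun t : ℝ => a i + t) 1 0 := (hasDerivAt_id (0 : ℝ)).const_add (a i)
    simpa using h1.cos
  have h2 : ∀ t : ℝ, cosDist (z + Pi.single i (t : AddCircle (2 * Real.pi))) =
      (cosDist z + cosCoord i z) - cosCoord i (z + Pi.single i (t : AddCircle (2 * Real.pi))) := by
    intro t
    fin_cases i <;> simp [cosDist, cosCoord] <;> ring
  simp only [h2]
  simpa using h.const_sub (cosDist z + cosCoord i z)

/-- A smooth truncation at scale `r` of (twice) the logarithm of the distance to the origin. -/
noncomputable def logBump (r : ℝ) (z : T2) : ℝ := Real.log (5 / (r ^ 2 + cosDist z))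

section LogBump

variable {r : ℝ}

lemma sq_add_cosDist_pos (hr : 0 < r) (z : T2) : 0 < r ^ 2 + cosDist z := by
  have := cosDist_nonneg z
  positivity

lemma isSmooth_logBump (hr : 0 < r) : IsSmooth (logBump r) := by
  refine ContDiff.log (ContDiff.div contDiff_const (contDiff_const.add isSmooth_cosDist) ?_) ?_
  · exact fun x => (sq_add_cosDist_pos hr _).ne'
  · exact fun x => (div_pos (by norm_num) (sq_add_cosDist_pos hr _)).ne'

/-- The `5` in `logBump` is the maximum of `r² + cosDist` allowed by `r ≤ 1` and `cosDist ≤ 4`. It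
makes the bump nonnegative, as Markov's inequality requires. -/
lemma one_le_five_div (hr : 0 < r) (hr1 : r ≤ 1) (z : T2) : 1 ≤ 5 / (r ^ 2 + cosDist z) := by
  rw [le_div_iff₀ (sq_add_cosDist_pos hr z)]
  nlinarith [cosDist_le z]

lemma logBump_nonneg (hr : 0 < r) (hr1 : r ≤ 1) (z : T2) : 0 ≤ logBump r z :=
  Real.log_nonneg (one_le_five_div hr hr1 z)

/-- The crude bound `log t ≤ 2√t` is enough: it controls the `L²` part by the same integral as the
gradient part. -/
lemma logBump_sq_le (hr : 0 < r) (hr1 : r ≤ 1) (z : T2) :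
    logBump r z ^ 2 ≤ 20 * (r ^ 2 + cosDist z)⁻¹ := by
  have h1 := one_le_five_div hr hr1 z
  have h0 : 0 ≤ 5 / (r ^ 2 + cosDist z) := by linarith
  have h2 : logBump r z ≤ 2 * √(5 / (r ^ 2 + cosDist z)) := by
    have := Real.log_le_sub_one_of_pos (Real.sqrt_pos.2 (zero_lt_one.trans_le h1))
    rw [Real.log_sqrt h0] at this
    rw [logBump]
    linarith
  calc logBump r z ^ 2 ≤ (2 * √(5 / (r ^ 2 + cosDist z))) ^ 2 :=
        pow_le_pow_left₀ (logBump_nonneg hr hr1 z) h2 2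
    _ = 20 * (r ^ 2 + cosDist z)⁻¹ := by
        rw [mul_pow, Real.sq_sqrt h0, div_eq_mul_inv]; ring

lemma pderiv_logBump (hr : 0 < r) (i : Fin 2) (z : T2) :
    pderiv i (logBump r) z = -(sinCoord i z * (r ^ 2 + cosDist z)⁻¹) := by
  have hpos := sq_add_cosDist_pos hr
  have h : ∀ z, logBump r z = Real.log 5 - Real.log (r ^ 2 + cosDist z) := fun z =>
    Real.log_div (by norm_num) (hpos z).ne'
  have h1 := (((hasDerivAt_cosDist i z).const_add (r ^ 2)).log (by simpa using (hpos z).ne')).const_sub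
    (Real.log 5)
  simp only [pderiv, h]
  rw [h1.deriv]
  simp [div_eq_mul_inv]

/-- Since `sin² ≤ 2(1 - cos)`, the numerator cancels one factor of the squared denominator. -/
lemma sum_pderiv_logBump_sq_le (hr : 0 < r) (z : T2) :
    pderiv 0 (logBump r) z ^ 2 + pderiv 1 (logBump r) z ^ 2 ≤ 2 * (r ^ 2 + cosDist z)⁻¹ := by
  have hpos := sq_add_cosDist_pos hr z
  rw [pderiv_logBump hr, pderiv_logBump hr]
  have hs : ∀ i, sinCoord i z ^ 2 ≤ 2 * (1 - cosCoord i z) := fun i => by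
    nlinarith [sinCoord_sq_add_cosCoord_sq i z, sq_nonneg (1 - cosCoord i z)]
  have h1 : sinCoord 0 z ^ 2 + sinCoord 1 z ^ 2 ≤ 2 * (r ^ 2 + cosDist z) := by
    have := hs 0
    have := hs 1
    have : cosDist z = (1 - cosCoord 0 z) + (1 - cosCoord 1 z) := rfl
    nlinarith [sq_nonneg r]
  calc _ = (sinCoord 0 z ^ 2 + sinCoord 1 z ^ 2) * ((r ^ 2 + cosDist z)⁻¹) ^ 2 := by ring
    _ ≤ 2 * (r ^ 2 + cosDist z) * ((r ^ 2 + cosDist z)⁻¹) ^ 2 := by gcongr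
    _ = _ := by field_simp

lemma continuous_inv_cosDist (hr : 0 < r) : Continuous fun z => (r ^ 2 + cosDist z)⁻¹ :=
  (continuous_const.add isSmooth_cosDist.continuous).inv₀ fun z => (sq_add_cosDist_pos hr z).ne'

lemma integrable_of_continuous {φ : T2 → ℝ} (hφ : Continuous φ) (ν : Measure T2)
    [IsFiniteMeasure ν] : Integrable φ ν := by
  obtain ⟨C, hC⟩ := isCompact_univ.exists_bound_of_continuousOn hφ.continuousOn
  exact Integrable.of_bound hφ.aestronglyMeasurable C (.of_forall fun x => hC x (mem_univ x))

/-- By Fubini on `[-π, π]²`: the inner integral costs one power of the distance, and the outer one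
produces the logarithm. -/
lemma integral_inv_cosDist_le (hr : 0 < r) (hr1 : r ≤ Real.exp (-1)) :
    ∫ z, (r ^ 2 + cosDist z)⁻¹ ≤ 54 * Real.pi * -Real.log r := by
  set c : AddCircle (2 * Real.pi) → ℝ := Real.cos_periodic.lift with hc
  have hcc : Continuous c := continuous_coinduced_dom.2 Real.continuous_cos
  have hc1 : ∀ a, c a ≤ 1 := fun a => by
    induction a using QuotientAddGroup.induction_on with
    | _ t => exact Real.cos_le_one t
  have hpos : ∀ a b, 0 < r ^ 2 + ((1 - c a) + (1 - c b)) := fun a b => by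
    have := hc1 a
    have := hc1 b
    have := sq_pos_of_pos hr
    linarith
  set F : AddCircle (2 * Real.pi) × AddCircle (2 * Real.pi) → ℝ :=
    fun x => (r ^ 2 + ((1 - c x.1) + (1 - c x.2)))⁻¹ with hF
  have hFc : Continuous F := Continuous.inv₀ (by fun_prop) fun x => (hpos _ _).ne'
  have hFi : Integrable F (volume.prod volume) := by
    obtain ⟨C, hC⟩ := isCompact_univ.exists_bound_of_continuousOn hFc.continuousOn
    exact Integrable.of_bound hFc.aestronglyMeasurable C (.of_forall fun x => hC x (mem_univ x))
  have hpi : -Real.pi + 2 * Real.pi = Real.pi := by ring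
  have hle : -Real.pi ≤ Real.pi := by linarith [Real.pi_pos]
  have h1 : ∫ z, (r ^ 2 + cosDist z)⁻¹ = ∫ x, F x ∂(volume.prod volume) :=
    (volume_preserving_finTwoArrow (AddCircle (2 * Real.pi))).integral_comp' F
  have hin : ∀ a : ℝ, ∫ b, F ((a : AddCircle (2 * Real.pi)), b) ≤
      3 * Real.pi / √(r ^ 2 + (1 - Real.cos a)) := by
    intro a
    rw [← AddCircle.intervalIntegral_preimage (2 * Real.pi) (-Real.pi), hpi]
    have := integral_inv_add_one_sub_cos_le (A := r ^ 2 + (1 - Real.cos a))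
      (by nlinarith [Real.cos_le_one a, sq_pos_of_pos hr])
    simp only [add_assoc] at this
    exact this
  rw [h1, integral_prod _ hFi, ← AddCircle.intervalIntegral_preimage (2 * Real.pi) (-Real.pi), hpi]
  refine le_trans ?_ (integral_inv_sqrt_add_one_sub_cos_le hr hr1)
  refine intervalIntegral.integral_mono_on hle ?_ ?_ fun a _ => hin a
  · obtain ⟨C, hC⟩ := isCompact_univ.exists_bound_of_continuousOn hFc.continuousOn
    have h3 : Continuous fun a => ∫ b, F (a, b) :=
      continuous_of_dominated (bound := fun _ => C)
        (fun a => (hFc.comp (Continuous.prodMk_right a)).aestronglyMeasurable)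
        (fun a => .of_forall fun b => hC _ (mem_univ _)) (integrable_const _)
        (.of_forall fun b => hFc.comp (Continuous.prodMk_left b))
    exact (h3.comp (AddCircle.continuous_mk' _)).intervalIntegrable _ _
  · refine Continuous.intervalIntegrable ?_ _ _
    refine Continuous.div (by fun_prop) (by fun_prop) fun a => ?_
    exact (Real.sqrt_pos.2 (by nlinarith [Real.cos_le_one a, sq_pos_of_pos hr])).ne'

lemma smoothH1Norm_translate (φ : T2 → ℝ) (s : T2) :
    smoothH1Norm (fun x => φ (x + s)) = smoothH1Norm φ := by
  simp only [smoothH1Norm, pderiv_comp_add_right]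
  rw [integral_add_right_eq_self (fun x => φ x ^ 2) s]
  have h : ∀ i, ∫ x, pderiv i φ (x + s) ^ 2 = ∫ x, pderiv i φ x ^ 2 := fun i =>
    integral_add_right_eq_self (fun x => pderiv i φ x ^ 2) s
  simp only [h]

lemma smoothH1Norm_const_mul (c : ℝ) (φ : T2 → ℝ) :
    smoothH1Norm (fun x => c * φ x) = |c| * smoothH1Norm φ := by
  have h : ∀ i x, pderiv i (fun x => c * φ x) x = c * pderiv i φ x := fun i x =>
    deriv_const_mul_field c
  simp only [smoothH1Norm, h, mul_pow, integral_const_mul, ← Finset.mul_sum, ← mul_add]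
  rw [Real.sqrt_mul (sq_nonneg c), Real.sqrt_sq_eq_abs]

lemma smoothH1Norm_logBump_le (hr : 0 < r) (hr1 : r ≤ Real.exp (-1)) :
    smoothH1Norm (logBump r) ≤ 70 * √(-Real.log r) := by
  have hr1' : r ≤ 1 := hr1.trans (Real.exp_le_one_iff.2 (by norm_num))
  have hsm := isSmooth_logBump hr
  have hq : Integrable (fun z : T2 => (r ^ 2 + cosDist z)⁻¹) volume :=
    integrable_of_continuous (continuous_inv_cosDist hr) _
  have hi0 : Integrable (fun z => logBump r z ^ 2) volume :=
    integrable_of_continuous (hsm.continuous.pow 2) _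
  have hi : ∀ i, Integrable (fun z => pderiv i (logBump r) z ^ 2) volume := fun i =>
    integrable_of_continuous ((hsm.pderiv i).continuous.pow 2) _
  have hlog : 1 ≤ -Real.log r := by
    have : Real.log r ≤ -1 := by simpa using Real.log_le_log hr hr1
    linarith
  have h1 : ∫ z, logBump r z ^ 2 ≤ 20 * ∫ z, (r ^ 2 + cosDist z)⁻¹ := by
    rw [← integral_const_mul]
    exact integral_mono hi0 (hq.const_mul _) (logBump_sq_le hr hr1')
  have h2 : (∫ z, pderiv 0 (logBump r) z ^ 2) + ∫ z, pderiv 1 (logBump r) z ^ 2 ≤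
      2 * ∫ z, (r ^ 2 + cosDist z)⁻¹ := by
    rw [← integral_const_mul, ← integral_add (hi 0) (hi 1)]
    exact integral_mono ((hi 0).add (hi 1)) (hq.const_mul _) (sum_pderiv_logBump_sq_le hr)
  have h3 := integral_inv_cosDist_le hr hr1
  rw [smoothH1Norm, Fin.sum_univ_two, Real.sqrt_le_left (by positivity), mul_pow,
    Real.sq_sqrt (by linarith)]
  -- Numerically, `(20 + 2) · 54π < 70²`.
  nlinarith [Real.pi_lt_d2]

lemma two_mul_neg_log_le_logBump (hr : 0 < r) {z : T2} (hz : ‖z‖ ≤ r) :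
    2 * -Real.log r ≤ logBump r z := by
  have h1 := cosDist_le_sq hz
  have h2 : (r ^ 2)⁻¹ ≤ 5 / (r ^ 2 + cosDist z) := by
    rw [inv_eq_one_div, div_le_div_iff₀ (by positivity) (sq_add_cosDist_pos hr z)]
    nlinarith [sq_nonneg r]
  have h3 := Real.log_le_log (by positivity) h2
  rw [Real.log_inv, Real.log_pow] at h3
  rw [logBump]
  push_cast at h3
  linarith

end LogBump

lemma abs_integral_le_of_hMinusOneNorm_le {μ : Measure T2} {K N : ℝ} (hK : 0 ≤ K)
    (hμ : hMinusOneNorm μ ≤ ENNReal.ofReal K) {φ : T2 → ℝ} (hφ : IsSmooth φ) (hN : 0 < N)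
    (hφN : smoothH1Norm φ ≤ N) : |∫ x, φ x ∂μ| ≤ K * N := by
  have h1 : smoothH1Norm (fun x => N⁻¹ * φ x) ≤ 1 := by
    rw [smoothH1Norm_const_mul, abs_of_pos (inv_pos.2 hN), inv_mul_le_iff₀ hN, mul_one]
    exact hφN
  have h2 : IsSmooth fun x => N⁻¹ * φ x := (IsSmooth.const N⁻¹).mul hφ
  have h3 : ENNReal.ofReal |∫ x, N⁻¹ * φ x ∂μ| ≤ ENNReal.ofReal K :=
    (le_iSup₂_of_le (f := fun ψ (_ : IsSmooth ψ) => ⨆ _ : smoothH1Norm ψ ≤ 1,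
      ENNReal.ofReal |∫ x, ψ x ∂μ|) _ h2 (le_iSup_of_le h1 le_rfl)).trans hμ
  rw [ENNReal.ofReal_le_ofReal_iff hK, integral_const_mul, abs_mul, abs_of_pos (inv_pos.2 hN),
    inv_mul_le_iff₀ hN] at h3
  linarith

/-- A measure in `H⁻¹` has small balls of mass `O(|log r|^{-1/2})`. -/
lemma measureReal_closedBall_le {μ : Measure T2} [IsFiniteMeasure μ] {K r : ℝ} (hK : 0 ≤ K)
    (hμ : hMinusOneNorm μ ≤ ENNReal.ofReal K) (hr : 0 < r) (hr1 : r ≤ Real.exp (-1)) (x : T2) :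
    μ.real (Metric.closedBall x r) ≤ 35 * K / √(-Real.log r) := by
  have hr1' : r ≤ 1 := hr1.trans (Real.exp_le_one_iff.2 (by norm_num))
  have hlog : 1 ≤ -Real.log r := by
    have : Real.log r ≤ -1 := by simpa using Real.log_le_log hr hr1
    linarith
  have hs : 0 < √(-Real.log r) := Real.sqrt_pos.2 (by linarith)
  have hsm := (isSmooth_logBump hr).comp_add_right (-x)
  have h1 := abs_integral_le_of_hMinusOneNorm_le hK hμ hsm (N := 70 * √(-Real.log r))
    (by positivity) ((smoothH1Norm_translate _ _).trans_le (smoothH1Norm_logBump_le hr hr1))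
  -- Markov's inequality at level `2|log r|`; the constant `35` is `70 / 2`.
  have h2 := mul_meas_ge_le_integral_of_nonneg (μ := μ)
    (.of_forall fun y => logBump_nonneg hr hr1' (y + -x))
    (integrable_of_continuous hsm.continuous μ) (2 * -Real.log r)
  have h3 : μ.real (Metric.closedBall x r) ≤
      μ.real {y | 2 * -Real.log r ≤ logBump r (y + -x)} := by
    refine measureReal_mono fun y hy => two_mul_neg_log_le_logBump hr ?_
    rw [← sub_eq_add_neg, ← dist_eq_norm]
    exact hy
  have h4 : 2 * -Real.log r * μ.real (Metric.closedBall x r) ≤ K * (70 * √(-Real.log r)) :=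
    (mul_le_mul_of_nonneg_left h3 (by linarith)).trans (h2.trans ((le_abs_self _).trans h1))
  rw [le_div_iff₀ hs]
  have h5 := Real.mul_self_sqrt (show 0 ≤ -Real.log r by linarith)
  have h6 : 2 * √(-Real.log r) * (μ.real (Metric.closedBall x r) * √(-Real.log r)) ≤
      2 * √(-Real.log r) * (35 * K) := by
    linear_combination h4 + 2 * μ.real (Metric.closedBall x r) * h5
  exact le_of_mul_le_mul_left h6 (by positivity)

end TorusNash

namespace TorusNash

/-! ### Averaged correlations -/

variable {f : T2 → ℝ} {G : T2 → EuclideanSpace ℝ (Fin 2)}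

lemma toReal_eLpNorm_two_eq_sqrt {α : Type*} {m : MeasurableSpace α} {ν : Measure α}
    {E : Type*} [NormedAddCommGroup E] {g : α → E} (hg : MemLp g 2 ν) :
    (eLpNorm g 2 ν).toReal = √(∫ x, ‖g x‖ ^ 2 ∂ν) := by
  rw [hg.eLpNorm_eq_integral_rpow_norm (by simp) (by simp),
    ENNReal.toReal_ofReal (Real.rpow_nonneg (integral_nonneg fun x => by positivity) _),
    Real.sqrt_eq_rpow]
  norm_num

/-- Write `f(x+s) = f(x) + (f(x+s) - f(x))` and apply Cauchy–Schwarz with the translation estimate.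
-/
lemma MemH1With.le_integral_mul_translate (h : MemH1With f G) {s : T2} {c : ℝ}
    (hs : ‖s 0‖ + ‖s 1‖ ≤ c) :
    (∫ x, f x ^ 2) - c * √(∫ x, f x ^ 2) * √(∫ x, ‖G x‖ ^ 2) ≤ ∫ x, f x * f (x + s) := by
  have hτ := memLp_comp_add_right h.memLp s
  have h1 : |∫ x, f x * (f (x + s) - f x)| ≤
      √(∫ x, f x ^ 2) * (c * √(∫ x, ‖G x‖ ^ 2)) := by
    refine (abs_integral_mul_le_eLpNorm_two h.memLp (hτ.sub h.memLp)).trans ?_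
    have h2 := toReal_eLpNorm_two_eq_sqrt h.memLp
    simp only [Real.norm_eq_abs, sq_abs] at h2
    rw [h2, ← toReal_eLpNorm_two_eq_sqrt h.memLp_grad]
    have h3 := ENNReal.toReal_mono (ENNReal.mul_ne_top ENNReal.ofReal_ne_top
      h.memLp_grad.eLpNorm_ne_top) (h.eLpNorm_translate_le s)
    rw [ENNReal.toReal_mul, ENNReal.toReal_ofReal (by positivity)] at h3
    refine mul_le_mul_of_nonneg_left (h3.trans ?_) (Real.sqrt_nonneg _)
    exact mul_le_mul_of_nonneg_right hs ENNReal.toReal_nonneg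
  have h4 : ∫ x, f x * (f (x + s) - f x) = (∫ x, f x * f (x + s)) - ∫ x, f x ^ 2 := by
    have hi : Integrable (fun x => f x * f (x + s)) volume := h.memLp.integrable_mul hτ
    rw [← integral_sub hi h.memLp.integrable_sq]
    exact integral_congr_ae (.of_forall fun x => by simp; ring)
  rw [h4] at h1
  linarith [neg_le_of_abs_le h1]

lemma integrable_mul_translate_prod (hf : Integrable f volume) :
    Integrable (fun z : T2 × T2 => f z.1 * f (z.1 + z.2)) (volume.prod volume) :=
  (measurePreserving_prod_add volume volume).integrable_comp_of_integrable (hf.mul_prod hf)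

lemma integral_integral_mul_translate (hf : Integrable f volume) (B : Set T2) :
    ∫ s in B, ∫ x, f x * f (x + s) = ∫ x, f x * ∫ s in B, f (x + s) := by
  have h1 : Integrable (Function.uncurry fun x s => f x * f (x + s))
      (volume.prod (volume.restrict B)) := by
    refine (integrable_mul_translate_prod hf).mono_measure ?_
    exact Measure.prod_mono le_rfl Measure.restrict_le_self
  rw [← integral_integral_swap h1]
  simp only [integral_const_mul]

lemma integrable_integral_mul_translate (hf : Integrable f volume) :
    Integrable (fun s => ∫ x, f x * f (x + s)) volume :=
  (integrable_mul_translate_prod hf).integral_prod_right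

lemma norm_apply_le_pi (s : T2) (i : Fin 2) : ‖s i‖ ≤ Real.pi := by
  have := AddCircle.norm_le_half_period (2 * Real.pi) (x := s i) (by positivity)
  rwa [abs_of_pos Real.two_pi_pos, mul_div_cancel_left₀ _ two_ne_zero] at this

/-- Poincaré's inequality for mean-free functions. -/
lemma MemH1With.poincare (h : MemH1With f G) (h0 : ∫ x, f x = 0) :
    ∫ x, f x ^ 2 ≤ 40 * ∫ x, ‖G x‖ ^ 2 := by
  have hf : Integrable f volume := h.memLp.integrable (by norm_num)
  set n := √(∫ x, f x ^ 2) with hn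
  set d := √(∫ x, ‖G x‖ ^ 2) with hd
  have hnn : ∫ x, f x ^ 2 = n ^ 2 := (Real.sq_sqrt (integral_nonneg fun x => sq_nonneg _)).symm
  have hdd : ∫ x, ‖G x‖ ^ 2 = d ^ 2 := (Real.sq_sqrt (integral_nonneg fun x => sq_nonneg _)).symm
  -- Averaged over the whole torus the correlation is `(∫ f)² = 0`, while each one is at least `n² -
  -- 2πnd`. Hence `n ≤ 2πd`, and `4π² < 40`.
  have h1 : ∫ s, ∫ x, f x * f (x + s) = 0 := by
    have := integral_integral_mul_translate hf univ
    simp only [Measure.restrict_univ, integral_add_left_eq_self (fun s => f s), h0, mul_zero,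
      integral_zero] at this
    exact this
  have h2 : ∫ _ : T2, (n ^ 2 - 2 * Real.pi * n * d) ≤ 0 := by
    rw [← h1]
    refine integral_mono (integrable_const _) (integrable_integral_mul_translate hf) fun s => ?_
    rw [← hnn]
    exact h.le_integral_mul_translate (by linarith [norm_apply_le_pi s 0, norm_apply_le_pi s 1])
  have hV : 0 < (volume : Measure T2).real univ :=
    ENNReal.toReal_pos (NeZero.ne _) (measure_ne_top _ _)
  rw [integral_const, smul_eq_mul] at h2
  have h3 : n ^ 2 - 2 * Real.pi * n * d ≤ 0 := nonpos_of_mul_nonpos_right h2 hV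
  have hn0 : 0 ≤ n := Real.sqrt_nonneg _
  have hd0 : 0 ≤ d := Real.sqrt_nonneg _
  have h4 : n ≤ 2 * Real.pi * d := by
    rcases hn0.eq_or_lt with h | h
    · rw [← h]; positivity
    · refine le_of_mul_le_mul_left ?_ h
      linarith
  rw [hnn, hdd]
  calc n ^ 2 ≤ (2 * Real.pi * d) ^ 2 := pow_le_pow_left₀ hn0 h4 2
    _ = 4 * Real.pi ^ 2 * d ^ 2 := by ring
    _ ≤ 40 * d ^ 2 := by
      gcongr
      nlinarith [Real.pi_lt_d2, Real.pi_pos]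

/-- The metric is the sup metric, so balls are squares of side `2r`. -/
lemma volume_closedBall_eq (x : T2) {r : ℝ} (hr : 0 ≤ r) (hr1 : r ≤ 1) :
    volume (Metric.closedBall x r) = ENNReal.ofReal (4 * r ^ 2) := by
  rw [volume_pi_closedBall x hr]
  simp only [AddCircle.volume_closedBall, Fin.prod_univ_two]
  rw [min_eq_right (by linarith [Real.pi_gt_three]), ← ENNReal.ofReal_mul (by positivity)]
  ring_nf

/-- If `f` has mass at most `E` on balls of radius `r`, then averaging `f` at scale `r` gives
a bound for its `L²` norm. -/
lemma MemH1With.integral_sq_le_of_ball (h : MemH1With f G) {r E : ℝ} (hr : 0 < r) (hr1 : r ≤ 1)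
    (hE : ∀ x, ∫ y in Metric.closedBall x r, |f y| ≤ E) :
    ∫ x, f x ^ 2 ≤ 4 * r ^ 2 * (∫ x, ‖G x‖ ^ 2) + (∫ x, |f x|) * E / (2 * r ^ 2) := by
  have hf : Integrable f volume := h.memLp.integrable (by norm_num)
  have hf' : Integrable (fun x => |f x|) volume := hf.abs
  set n := √(∫ x, f x ^ 2) with hn
  set d := √(∫ x, ‖G x‖ ^ 2) with hd
  have hnn : ∫ x, f x ^ 2 = n ^ 2 := (Real.sq_sqrt (integral_nonneg fun x => sq_nonneg _)).symm
  have hdd : ∫ x, ‖G x‖ ^ 2 = d ^ 2 := (Real.sq_sqrt (integral_nonneg fun x => sq_nonneg _)).symm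
  set B : Set T2 := Metric.closedBall 0 r with hB
  have hball : ∀ x, ∫ s in B, |f (x + s)| ≤ E := by
    intro x
    have h1 := (measurePreserving_add_left volume x).setIntegral_preimage_emb
      (measurableEmbedding_addLeft x) (fun y => |f y|) (Metric.closedBall x r)
    rw [preimage_add_closedBall, sub_self] at h1
    exact h1.trans_le (hE x)
  have h1 : ∫ s in B, ∫ x, |f x| * |f (x + s)| ≤ (∫ x, |f x|) * E := by
    rw [integral_integral_mul_translate hf' B, ← integral_mul_const]
    refine integral_mono_of_nonneg (.of_forall fun x => ?_) (hf'.mul_const E)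
      (.of_forall fun x => mul_le_mul_of_nonneg_left (hball x) (abs_nonneg _))
    exact mul_nonneg (abs_nonneg _) (integral_nonneg fun s => abs_nonneg _)
  have h2 : ∫ s in B, (n ^ 2 - 2 * r * n * d) ≤ ∫ s in B, ∫ x, |f x| * |f (x + s)| := by
    refine setIntegral_mono_on (integrable_const _)
      (integrable_integral_mul_translate hf').integrableOn Metric.isClosed_closedBall.measurableSet
      fun s hs => ?_
    have hs' : ‖s‖ ≤ r := by simpa [hB] using hs
    have h3 := h.le_integral_mul_translate (s := s) (c := 2 * r)
      (by linarith [norm_le_pi_norm s 0, norm_le_pi_norm s 1])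
    rw [← hn, ← hd, hnn] at h3
    refine h3.trans (integral_mono (h.memLp.integrable_mul (memLp_comp_add_right h.memLp s))
      (h.memLp.abs.integrable_mul (memLp_comp_add_right h.memLp s).abs) fun x => ?_)
    exact (le_abs_self _).trans (abs_mul _ _).le
  rw [setIntegral_const, smul_eq_mul, measureReal_def, volume_closedBall_eq 0 hr.le hr1,
    ENNReal.toReal_ofReal (by positivity)] at h2
  have h3 : n ^ 2 - 2 * r * n * d ≤ (∫ x, |f x|) * E / (4 * r ^ 2) := by
    rw [le_div_iff₀ (by positivity)]
    linarith
  have h4 : (∫ x, |f x|) * E / (2 * r ^ 2) = 2 * ((∫ x, |f x|) * E / (4 * r ^ 2)) := by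
    field_simp; norm_num
  rw [hnn, hdd, h4]
  -- Young's inequality `2rnd ≤ n²/2 + 2r²d²` absorbs the cross term.
  nlinarith [sq_nonneg (n - 2 * r * d)]

end TorusNash

namespace TorusNash

/-! ### Local mass of functions with a decomposition -/

/-- The decomposition makes `f - w` a density of `μ`, hence nonnegative a.e., so `|f| ≤ (f - w) +
|w|`. -/
lemma integral_abs_le_measureReal_add {f w : T2 → ℝ} {μ : Measure T2} [IsFiniteMeasure μ]
    (hf : Integrable f volume) (hw : Integrable w volume)
    (h : (volume : Measure T2).withDensityᵥ f =
      μ.toSignedMeasure + (volume : Measure T2).withDensityᵥ w) {E : Set T2} (hE : MeasurableSet E) :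
    ∫ x in E, |f x| ≤ μ.real E + ∫ x in E, |w x| := by
  have h1 : ∀ E, MeasurableSet E → ∫ x in E, (f x - w x) = μ.real E := by
    intro E hE
    have h2 := congrArg (fun v : SignedMeasure T2 => v E) h
    simp only [FunLike.coe_add, Pi.add_apply] at h2
    rw [withDensityᵥ_apply hf hE, withDensityᵥ_apply hw hE,
      Measure.toSignedMeasure_apply_measurable hE] at h2
    rw [integral_sub hf.integrableOn hw.integrableOn, h2]
    ring
  have h3 : 0 ≤ᵐ[volume] fun x => f x - w x :=
    ae_nonneg_of_forall_setIntegral_nonneg (hf.sub hw) fun E hE _ => by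
      rw [h1 E hE]; exact measureReal_nonneg
  have hs : Integrable (fun x => f x - w x) volume := hf.sub hw
  rw [← h1 E hE, ← integral_add hs.integrableOn hw.abs.integrableOn]
  refine integral_mono_ae hf.abs.integrableOn (hs.add hw.abs).integrableOn ?_
  filter_upwards [ae_restrict_of_ae h3] with x hx
  have : 0 ≤ f x - w x := hx
  calc |f x| = |(f x - w x) + w x| := by ring_nf
    _ ≤ |f x - w x| + |w x| := abs_add_le _ _
    _ = _ := by rw [abs_of_nonneg this]

/-- Hölder's inequality on `E`. For `p = ∞` the conventions `∞.toReal = 0` and `1 / 0 = 0` give the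
correct exponent `1`. -/
lemma setIntegral_abs_le_rpow {w : T2 → ℝ} {p : ℝ≥0∞} (hp : 1 < p) {K : ℝ} (hK : 0 ≤ K)
    (hw : MemLp w p volume) (hwK : eLpNorm w p volume ≤ ENNReal.ofReal K) (E : Set T2) :
    ∫ x in E, |w x| ≤ K * (volume : Measure T2).real E ^ (1 - 1 / p.toReal) := by
  have hθ : 0 ≤ 1 - 1 / p.toReal := by
    rcases eq_or_ne p ∞ with rfl | h
    · simp
    · have : 1 ≤ p.toReal := by
        simpa using ENNReal.toReal_mono h hp.le
      rw [sub_nonneg, div_le_one (by linarith)]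
      exact this
  have hwE : AEStronglyMeasurable w (volume.restrict E) := hw.aestronglyMeasurable.restrict
  have h1 := eLpNorm_le_eLpNorm_mul_rpow_measure_univ hp.le hwE
  rw [Measure.restrict_apply_univ, ENNReal.toReal_one, div_one] at h1
  have h2 : eLpNorm w 1 (volume.restrict E) ≤
      ENNReal.ofReal K * volume E ^ (1 - 1 / p.toReal) :=
    h1.trans (mul_le_mul_left ((eLpNorm_mono_measure _ Measure.restrict_le_self).trans hwK) _)
  have h3 : ∫ x in E, |w x| = (eLpNorm w 1 (volume.restrict E)).toReal := by
    rw [eLpNorm_one_eq_lintegral_enorm, ← integral_norm_eq_lintegral_enorm hwE]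
    simp only [Real.norm_eq_abs]
  rw [h3]
  have h4 := ENNReal.toReal_mono (ENNReal.mul_ne_top ENNReal.ofReal_ne_top
    (ENNReal.rpow_ne_top_of_nonneg hθ (measure_ne_top _ _))) h2
  rwa [ENNReal.toReal_mul, ENNReal.toReal_ofReal hK, ← ENNReal.toReal_rpow] at h4

lemma one_sub_one_div_toReal_mem {p : ℝ≥0∞} (hp : 1 < p) :
    0 < 1 - 1 / p.toReal ∧ 1 - 1 / p.toReal ≤ 1 := by
  refine ⟨?_, by linarith [show 0 ≤ 1 / p.toReal by positivity]⟩
  rcases eq_or_ne p ∞ with rfl | h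
  · simp
  · have : 1 < p.toReal := by
      simpa using (ENNReal.toReal_lt_toReal ENNReal.one_ne_top h).2 hp
    rw [sub_pos, div_lt_one (by linarith)]
    exact this

/-- With `ℓ = |log r| ≥ 1`, one has `r^(2θ) = e^(-2θℓ) ≤ 1/(2θℓ) ≤ 1/(2θ√ℓ)`. -/
lemma rpow_four_mul_sq_le {θ r : ℝ} (hθ : 0 < θ) (hθ1 : θ ≤ 1) (hr : 0 < r)
    (hr1 : r ≤ Real.exp (-1)) : (4 * r ^ 2) ^ θ ≤ 2 / θ / √(-Real.log r) := by
  have hlog : 1 ≤ -Real.log r := by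
    have : Real.log r ≤ -1 := by simpa using Real.log_le_log hr hr1
    linarith
  set ℓ := -Real.log r with hℓ
  have h1 : (4 : ℝ) ^ θ ≤ 4 := by
    simpa using Real.rpow_le_rpow_of_exponent_le (show (1 : ℝ) ≤ 4 by norm_num) hθ1
  have h2 : (r ^ 2) ^ θ = Real.exp (-(2 * θ * ℓ)) := by
    rw [Real.rpow_def_of_pos (by positivity), Real.log_pow, hℓ]
    push_cast
    ring_nf
  have h3 : Real.exp (-(2 * θ * ℓ)) ≤ 1 / (2 * θ * ℓ) := by
    rw [Real.exp_neg, ← one_div]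
    refine one_div_le_one_div_of_le (by positivity) ?_
    linarith [Real.add_one_le_exp (2 * θ * ℓ)]
  have h4 : √ℓ ≤ ℓ := by
    rw [Real.sqrt_le_left (by linarith)]
    nlinarith
  have h5 : 0 < √ℓ := Real.sqrt_pos.2 (by linarith)
  rw [Real.mul_rpow (by norm_num) (by positivity), h2]
  calc (4 : ℝ) ^ θ * Real.exp (-(2 * θ * ℓ)) ≤ 4 * (1 / (2 * θ * √ℓ)) := by
        refine mul_le_mul h1 (h3.trans ?_) (Real.exp_pos _).le (by norm_num)
        gcongr
    _ = 2 / θ / √ℓ := by field_simp; norm_num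

/-- Functions with a decomposition of size `K` have uniformly bounded mass, of order
`|log r|^{-1/2}` on balls of radius `r`. -/
lemma exists_local_mass_bound {p : ℝ≥0∞} (hp : 1 < p) {K : ℝ} (hK : 0 < K) :
    ∃ C : ℝ, 0 < C ∧ ∀ f : T2 → ℝ, Integrable f volume → HasDecomposition p K f →
      ∫ x, |f x| ≤ C ∧ ∀ (x : T2) (r : ℝ), 0 < r → r ≤ Real.exp (-1) →
        ∫ y in Metric.closedBall x r, |f y| ≤ C / √(-Real.log r) := by
  obtain ⟨hθ, hθ1⟩ := one_sub_one_div_toReal_mem hp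
  set θ := 1 - 1 / p.toReal with hθdef
  set V := (volume : Measure T2).real univ
  have hV : 0 ≤ V ^ θ := Real.rpow_nonneg measureReal_nonneg _
  refine ⟨K + K * V ^ θ + (35 * K + K * (2 / θ)), by positivity, ?_⟩
  rintro f hf ⟨μ, hμ, w, hw, hdec, hbound⟩
  have hwi : Integrable w volume := hw.integrable hp.le
  have hwK : eLpNorm w p volume ≤ ENNReal.ofReal K := le_add_self.trans hbound
  have hμK : hMinusOneNorm μ ≤ ENNReal.ofReal K := (le_add_self.trans le_self_add).trans hbound
  have hμ1 : μ.real univ ≤ K := by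
    refine ENNReal.toReal_le_of_le_ofReal hK.le ?_
    exact (le_self_add.trans le_self_add).trans hbound
  constructor
  · have h1 := integral_abs_le_measureReal_add hf hwi hdec MeasurableSet.univ
    have h2 := setIntegral_abs_le_rpow hp hK.le hw hwK univ
    rw [Measure.restrict_univ] at h1 h2
    have : 0 < 35 * K + K * (2 / θ) := by positivity
    linarith
  · intro x r hr hr1
    have hr1' : r ≤ 1 := hr1.trans (Real.exp_le_one_iff.2 (by norm_num))
    have h1 := integral_abs_le_measureReal_add hf hwi hdec
      (Metric.isClosed_closedBall (x := x) (ε := r)).measurableSet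
    have h2 := setIntegral_abs_le_rpow hp hK.le hw hwK (Metric.closedBall x r)
    have h3 := measureReal_closedBall_le hK.le hμK hr hr1 x
    rw [measureReal_def volume, volume_closedBall_eq x hr.le hr1',
      ENNReal.toReal_ofReal (by positivity), ← hθdef] at h2
    have h4 := mul_le_mul_of_nonneg_left (rpow_four_mul_sq_le hθ hθ1 hr hr1) hK.le
    calc _ ≤ 35 * K / √(-Real.log r) + K * (2 / θ / √(-Real.log r)) := by linarith
      _ = (35 * K + K * (2 / θ)) / √(-Real.log r) := by ring
      _ ≤ _ := by
        have : 0 ≤ K + K * V ^ θ := by positivity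
        exact div_le_div_of_nonneg_right (by linarith) (Real.sqrt_nonneg _)

end TorusNash

namespace TorusNash

/-! ### The concave profile -/

/-- The logarithmic factor `log (e² + x) ^ (-1/4)`. -/
noncomputable def logFactor (x : ℝ) : ℝ := Real.log (Real.exp 2 + x) ^ (-(1 / 4) : ℝ)

/-- The shift by `e²` gives `logFactor ^ 4 ≤ 1/2`, the smallness behind both concavity and
monotonicity of the profile. -/
lemma two_le_log_exp_two_add {x : ℝ} (hx : 0 ≤ x) : 2 ≤ Real.log (Real.exp 2 + x) := by
  rw [Real.le_log_iff_exp_le (by positivity)]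
  linarith

lemma logFactor_pos {x : ℝ} (hx : 0 ≤ x) : 0 < logFactor x :=
  Real.rpow_pos_of_pos (by linarith [two_le_log_exp_two_add hx]) _

lemma logFactor_pow_four {x : ℝ} (hx : 0 ≤ x) :
    logFactor x ^ 4 = (Real.log (Real.exp 2 + x))⁻¹ := by
  have h := two_le_log_exp_two_add hx
  rw [logFactor, ← Real.rpow_natCast, ← Real.rpow_mul (by linarith), ← Real.rpow_neg_one]
  norm_num

lemma logFactor_pow_four_le {x : ℝ} (hx : 0 ≤ x) : logFactor x ^ 4 ≤ 1 / 2 := by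
  rw [logFactor_pow_four hx, one_div]
  exact inv_anti₀ (by norm_num) (two_le_log_exp_two_add hx)

lemma logFactor_le_one {x : ℝ} (hx : 0 ≤ x) : logFactor x ≤ 1 := by
  by_contra! h
  have := one_le_pow₀ h.le (n := 4)
  linarith [logFactor_pow_four_le hx]

lemma logFactor_antitoneOn : AntitoneOn logFactor (Ici 0) := by
  intro x hx y hy hxy
  have hx' : (0 : ℝ) ≤ x := hx
  have h := two_le_log_exp_two_add hx'
  exact Real.rpow_le_rpow_of_nonpos (by linarith)
    (Real.log_le_log (by positivity) (by linarith)) (by norm_num)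

/-- Splitting `x/(e² + x) = 1 - e²/(e² + x)` writes the derivative as a polynomial in `logFactor`
plus a product of positive decreasing factors. -/
lemma hasDerivAt_mul_logFactor {x : ℝ} (hx : 0 ≤ x) :
    HasDerivAt (fun x => x * logFactor x)
      (logFactor x - logFactor x ^ 5 / 4 + Real.exp 2 / 4 * ((Real.exp 2 + x)⁻¹ * logFactor x ^ 5))
      x := by
  have h2 := two_le_log_exp_two_add hx
  have hpos : 0 < Real.exp 2 + x := by positivity
  have h5 : logFactor x ^ 5 = Real.log (Real.exp 2 + x) ^ (-(1 / 4) - 1 : ℝ) := by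
    rw [logFactor, ← Real.rpow_natCast, ← Real.rpow_mul (by linarith)]
    norm_num
  have h := (hasDerivAt_id x).mul
    ((((hasDerivAt_id x).const_add (Real.exp 2)).log hpos.ne').rpow_const (p := (-(1 / 4) : ℝ))
      (Or.inl (by simp only [id]; linarith)))
  refine h.congr_deriv ?_
  simp only [id]
  rw [h5]
  change 1 * logFactor x + _ = _
  field_simp
  ring

lemma antitoneOn_deriv_profile : AntitoneOn (fun x => logFactor x - logFactor x ^ 5 / 4 +
    Real.exp 2 / 4 * ((Real.exp 2 + x)⁻¹ * logFactor x ^ 5)) (Ici 0) := by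
  intro x hx y hy hxy
  have hx0 : (0 : ℝ) ≤ x := hx
  have hy0 : (0 : ℝ) ≤ y := hy
  have hle := logFactor_antitoneOn hx hy hxy
  have hv := logFactor_pow_four_le hx0
  have hu0 := logFactor_pos hy0
  have hv0 := logFactor_pos hx0
  dsimp only
  have h1 : logFactor y - logFactor y ^ 5 / 4 ≤ logFactor x - logFactor x ^ 5 / 4 := by
    generalize logFactor x = v at *
    generalize logFactor y = u at *
    -- This sum is the cofactor of `v - u` in `v⁵ - u⁵`; as `5v⁴ ≤ 5/2 < 4`, the map `u ↦ u - u⁵/4`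
    -- is increasing in this range.
    have ha : v ^ 4 + v ^ 3 * u + v ^ 2 * u ^ 2 + v * u ^ 3 + u ^ 4 ≤ 5 * v ^ 4 := by
      have e1 : v ^ 3 * u ≤ v ^ 3 * v := by gcongr
      have e2 : v ^ 2 * u ^ 2 ≤ v ^ 2 * v ^ 2 := by gcongr
      have e3 : v * u ^ 3 ≤ v * v ^ 3 := by gcongr
      have e4 : u ^ 4 ≤ v ^ 4 := by gcongr
      linarith
    have hb : 0 ≤ (v - u) * (4 - (v ^ 4 + v ^ 3 * u + v ^ 2 * u ^ 2 + v * u ^ 3 + u ^ 4)) :=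
      mul_nonneg (by linarith) (by linarith)
    linarith
  have h2 : (Real.exp 2 + y)⁻¹ * logFactor y ^ 5 ≤ (Real.exp 2 + x)⁻¹ * logFactor x ^ 5 := by
    gcongr
  have h3 := mul_le_mul_of_nonneg_left h2 (show 0 ≤ Real.exp 2 / 4 by positivity)
  linarith

section Profile

variable {A : ℝ}

/-- The profile `A x log (e² + x) ^ (-1/4)`. -/
noncomputable def profile (A x : ℝ) : ℝ := A * (x * logFactor x)

lemma hasDerivAt_profile {x : ℝ} (hx : 0 ≤ x) : HasDerivAt (profile A)
    (A * (logFactor x - logFactor x ^ 5 / 4 +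
      Real.exp 2 / 4 * ((Real.exp 2 + x)⁻¹ * logFactor x ^ 5))) x :=
  (hasDerivAt_mul_logFactor hx).const_mul A

lemma contDiffOn_profile : ContDiffOn ℝ 1 (profile A) (Ici 0) := by
  have hpos : ∀ x ∈ Ici (0 : ℝ), Real.exp 2 + x ≠ 0 := fun x hx =>
    (add_pos_of_pos_of_nonneg (Real.exp_pos 2) hx).ne'
  refine contDiffOn_const.mul (contDiffOn_id.mul (ContDiffOn.rpow_const_of_ne
    (ContDiffOn.log (contDiffOn_const.add contDiffOn_id) hpos) fun x hx => ?_))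
  exact (zero_lt_two.trans_le (two_le_log_exp_two_add hx)).ne'

lemma concaveOn_profile (hA : 0 < A) : ConcaveOn ℝ (Ici 0) (profile A) := by
  refine AntitoneOn.concaveOn_of_deriv (convex_Ici 0) contDiffOn_profile.continuousOn ?_ ?_
  · intro x hx
    exact (hasDerivAt_profile (interior_subset hx)).differentiableAt.differentiableWithinAt
  · intro x hx y hy hxy
    have hx' : x ∈ Ici (0 : ℝ) := interior_subset hx
    have hy' : y ∈ Ici (0 : ℝ) := interior_subset hy
    rw [(hasDerivAt_profile hx').deriv, (hasDerivAt_profile hy').deriv]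
    exact mul_le_mul_of_nonneg_left (antitoneOn_deriv_profile hx' hy' hxy) hA.le

lemma strictMonoOn_profile (hA : 0 < A) : StrictMonoOn (profile A) (Ici 0) := by
  refine strictMonoOn_of_deriv_pos (convex_Ici 0) contDiffOn_profile.continuousOn fun x hx => ?_
  have hx' : (0 : ℝ) ≤ x := interior_subset hx
  rw [(hasDerivAt_profile hx').deriv]
  have h1 := logFactor_pos hx'
  have h2 := logFactor_pow_four_le hx'
  have h3 : 0 ≤ Real.exp 2 / 4 * ((Real.exp 2 + x)⁻¹ * logFactor x ^ 5) := by positivity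
  have h4 : logFactor x ^ 5 ≤ logFactor x * (1 / 2) := by
    rw [pow_succ']; gcongr
  exact mul_pos hA (by linarith)

lemma tendsto_log_exp_two_add : Tendsto (fun x : ℝ => Real.log (Real.exp 2 + x)) atTop atTop :=
  Real.tendsto_log_atTop.comp (tendsto_atTop_add_const_left _ _ tendsto_id)

/-- Since `logFactor ≤ 1`, it dominates its fourth power `1 / log(e² + x)`, and the logarithm is at
most `3√x`. -/
lemma tendsto_profile (hA : 0 < A) : Tendsto (profile A) atTop atTop := by
  refine Tendsto.const_mul_atTop hA ?_
  have h1 : Tendsto (fun x : ℝ => √x / 3) atTop atTop :=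
    Real.tendsto_sqrt_atTop.atTop_div_const (by norm_num)
  refine tendsto_atTop_mono' _ ?_ h1
  filter_upwards [eventually_ge_atTop (Real.exp 2)] with x hx
  have hx0 : 0 < x := (Real.exp_pos 2).trans_le hx
  have hs : 0 < √x := Real.sqrt_pos.2 hx0
  have hL := two_le_log_exp_two_add hx0.le
  have h2 : Real.log (Real.exp 2 + x) ≤ 3 * √x := by
    have h3 := Real.log_le_sub_one_of_pos
      (Real.sqrt_pos.2 (show 0 < Real.exp 2 + x by positivity))
    rw [Real.log_sqrt (by positivity)] at h3
    have h4 : √(Real.exp 2 + x) ≤ 3 / 2 * √x := by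
      rw [Real.sqrt_le_left (by positivity), mul_pow, Real.sq_sqrt hx0.le]
      linarith
    linarith
  have h5 : (3 * √x)⁻¹ ≤ logFactor x := by
    calc (3 * √x)⁻¹ ≤ (Real.log (Real.exp 2 + x))⁻¹ := inv_anti₀ (by linarith) h2
      _ = logFactor x ^ 4 := (logFactor_pow_four hx0.le).symm
      _ ≤ logFactor x := pow_le_of_le_one (logFactor_pos hx0.le).le (logFactor_le_one hx0.le)
        (by norm_num)
  calc √x / 3 = x * (3 * √x)⁻¹ := by
        nth_rewrite 2 [← Real.mul_self_sqrt hx0.le]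
        field_simp
    _ ≤ x * logFactor x := by gcongr

lemma profile_zero : profile A 0 = 0 := by simp [profile]

lemma bijOn_profile (hA : 0 < A) : BijOn (profile A) (Ici 0) (Ici 0) := by
  refine ⟨fun x hx => ?_, (strictMonoOn_profile hA).injOn, fun y hy => ?_⟩
  · rw [mem_Ici, ← profile_zero (A := A)]
    exact (strictMonoOn_profile hA).monotoneOn (mem_Ici.2 le_rfl) hx hx
  · obtain ⟨b, hb, hb0⟩ :=
      ((tendsto_profile hA).eventually_ge_atTop y |>.and (eventually_ge_atTop 0)).exists
    have hc : ContinuousOn (profile A) (Icc 0 b) :=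
      contDiffOn_profile.continuousOn.mono Icc_subset_Ici_self
    obtain ⟨x, hx, hxy⟩ := intermediate_value_Icc hb0 hc ⟨profile_zero.trans_le hy, hb⟩
    exact ⟨x, hx.1, hxy⟩

lemma isLittleO_profile : profile A =o[atTop] fun x : ℝ => x := by
  have h1 : Tendsto logFactor atTop (nhds 0) :=
    (tendsto_rpow_neg_atTop (by norm_num : (0 : ℝ) < 1 / 4)).comp tendsto_log_exp_two_add
  have h2 := (isBigO_refl (fun x : ℝ => x) atTop).mul_isLittleO
    ((isLittleO_one_iff ℝ).2 h1)
  simp only [mul_one] at h2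
  exact h2.const_mul_left A

lemma isBigO_profile :
    profile A =O[atTop] fun x : ℝ => x * |Real.log x| ^ (-(1 / 4) : ℝ) := by
  refine IsBigO.const_mul_left ((isBigO_refl _ _).mul (IsBigO.of_bound 1 ?_)) A
  filter_upwards [eventually_gt_atTop 1] with x hx
  have hlog := Real.log_pos hx
  rw [one_mul, Real.norm_of_nonneg (logFactor_pos (by linarith)).le,
    Real.norm_of_nonneg (by positivity), abs_of_pos hlog]
  exact Real.rpow_le_rpow_of_nonpos hlog
    (Real.log_le_log (by linarith) (by linarith [Real.exp_pos 2])) (by norm_num)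

lemma upsilon_profile_le (hA : 0 < A) {y d : ℝ} (hy : 0 ≤ y) (hd : 0 ≤ d) (h : y ≤ profile A d) :
    upsilon (profile A) y ≤ d ^ 2 := by
  have hmem : y ∈ profile A '' Ici 0 := (bijOn_profile hA).surjOn hy
  have h1 : Function.invFunOn (profile A) (Ici 0) y ∈ Ici (0 : ℝ) := Function.invFunOn_mem hmem
  have h2 : profile A (Function.invFunOn (profile A) (Ici 0) y) = y := Function.invFunOn_eq hmem
  refine pow_le_pow_left₀ h1 ?_ 2
  rw [← (strictMonoOn_profile hA).le_iff_le h1 hd, h2]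
  exact h

end Profile

/-! ### Choice of the averaging scale and the bound by the profile -/

lemma exp_two_le : Real.exp 2 ≤ 8 := by
  have : Real.exp 2 = Real.exp 1 * Real.exp 1 := by rw [← Real.exp_add]; norm_num
  nlinarith [Real.exp_one_lt_d9, Real.exp_pos 1]

lemma one_third_le_logFactor {d : ℝ} (hd : 0 ≤ d) (hd1 : d ≤ 1) : 1 / 3 ≤ logFactor d := by
  have hL := two_le_log_exp_two_add hd
  have h3 : Real.log (Real.exp 2 + d) ≤ 3 := by
    rw [Real.log_le_iff_le_exp (by positivity)]
    have h1 : Real.exp 3 = Real.exp 2 * Real.exp 1 := by rw [← Real.exp_add]; norm_num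
    nlinarith [Real.exp_one_gt_d9, Real.add_one_le_exp 2]
  calc 1 / 3 ≤ (Real.log (Real.exp 2 + d))⁻¹ := by
        rw [one_div]; exact inv_anti₀ (by linarith) h3
    _ = logFactor d ^ 4 := (logFactor_pow_four hd).symm
    _ ≤ logFactor d := pow_le_of_le_one (logFactor_pos hd).le (logFactor_le_one hd) (by norm_num)

variable {f : T2 → ℝ} {G : T2 → EuclideanSpace ℝ (Fin 2)}

lemma MemH1With.integral_sq_le_of_local_mass (h : MemH1With f G) {C : ℝ} (hC : 0 < C)
    (h1 : ∫ x, |f x| ≤ C)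
    (h2 : ∀ (x : T2) (r : ℝ), 0 < r → r ≤ Real.exp (-1) →
      ∫ y in Metric.closedBall x r, |f y| ≤ C / √(-Real.log r))
    {d : ℝ} (hd : ∫ x, ‖G x‖ ^ 2 = d ^ 2) (hd1 : 1 ≤ d) :
    ∫ x, f x ^ 2 ≤ (4 + 9 * C ^ 2) * (d * logFactor d) := by
  have hd0 : 0 ≤ d := by linarith
  have hy := logFactor_pos hd0
  have hy1 := logFactor_le_one hd0
  have hL := two_le_log_exp_two_add hd0
  have hpow := logFactor_pow_four hd0
  set L := Real.log (Real.exp 2 + d) with hLdef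
  set y := logFactor d
  have hapos : 0 < Real.exp 2 + d := by positivity
  -- The ball mass is of order `L^(-1/2) = y²`, so `r²d²` and `y²/r²` balance at `r² ≈ y/d`; adding
  -- `e²` to `d` ensures `r ≤ e⁻¹`.
  set r := √(y / (Real.exp 2 + d)) with hr
  have hr2 : r ^ 2 = y / (Real.exp 2 + d) := Real.sq_sqrt (by positivity)
  have hr0 : 0 < r := Real.sqrt_pos.2 (by positivity)
  have hre : r ≤ Real.exp (-1) := by
    rw [hr, Real.sqrt_le_left (Real.exp_pos _).le, ← Real.exp_nat_mul, div_le_iff₀ hapos]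
    have e1 : Real.exp ((2 : ℕ) * (-1 : ℝ)) * Real.exp 2 = 1 := by
      rw [← Real.exp_add]; norm_num
    nlinarith [Real.exp_pos ((2 : ℕ) * (-1 : ℝ))]
  have hr1 : r ≤ 1 := hre.trans (Real.exp_le_one_iff.2 (by norm_num))
  -- In fact `-log r ≥ L/2`; the weaker `L/4` has the convenient square root `1/(2y²)`.
  have hlogr : L / 4 ≤ -Real.log r := by
    rw [hr, Real.log_sqrt (by positivity), Real.log_div hy.ne' hapos.ne', ← hLdef]
    have := Real.log_nonpos hy.le hy1
    linarith
  have hE : ∀ x, ∫ z in Metric.closedBall x r, |f z| ≤ 2 * C * y ^ 2 := by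
    intro x
    refine (h2 x r hr0 hre).trans ?_
    have h3 : (2 * y ^ 2)⁻¹ ≤ √(-Real.log r) := by
      refine Real.le_sqrt_of_sq_le (le_trans (le_of_eq ?_) hlogr)
      have : L = (y ^ 4)⁻¹ := by rw [hpow, inv_inv]
      rw [this]
      field_simp
      norm_num
    calc C / √(-Real.log r) ≤ C / (2 * y ^ 2)⁻¹ := by gcongr
      _ = 2 * C * y ^ 2 := by field_simp
  have hmain := h.integral_sq_le_of_ball hr0 hr1 hE
  rw [hd, hr2] at hmain
  have h4 : 4 * (y / (Real.exp 2 + d)) * d ^ 2 ≤ 4 * (d * y) := by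
    rw [mul_div_assoc', div_mul_eq_mul_div, div_le_iff₀ hapos]
    have : 0 ≤ d * y * Real.exp 2 := by positivity
    linarith
  have h5 : (∫ x, |f x|) * (2 * C * y ^ 2) / (2 * (y / (Real.exp 2 + d))) ≤
      9 * C ^ 2 * (d * y) := by
    calc _ ≤ C * (2 * C * y ^ 2) / (2 * (y / (Real.exp 2 + d))) := by gcongr
      _ = C ^ 2 * y * (Real.exp 2 + d) := by field_simp
      _ ≤ C ^ 2 * y * (9 * d) := by
        gcongr
        linarith [exp_two_le]
      _ = _ := by ring
  linarith

/-- For `d ≤ 1`, Poincaré gives `40d²` and `d ≤ 1 ≤ 3 logFactor d`, whence the constant `120`. -/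
lemma MemH1With.integral_sq_le_profile (h : MemH1With f G) (h0 : ∫ x, f x = 0) {C : ℝ} (hC : 0 < C)
    (h1 : ∫ x, |f x| ≤ C)
    (h2 : ∀ (x : T2) (r : ℝ), 0 < r → r ≤ Real.exp (-1) →
      ∫ y in Metric.closedBall x r, |f y| ≤ C / √(-Real.log r))
    {d : ℝ} (hd0 : 0 ≤ d) (hd : ∫ x, ‖G x‖ ^ 2 = d ^ 2) :
    ∫ x, f x ^ 2 ≤ profile (120 + 9 * C ^ 2) d := by
  have hy := logFactor_pos hd0
  have hdy : 0 ≤ d * logFactor d := by positivity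
  rcases le_total 1 d with hd1 | hd1
  · refine (h.integral_sq_le_of_local_mass hC h1 h2 hd hd1).trans ?_
    exact mul_le_mul_of_nonneg_right (by linarith) hdy
  · have h3 := h.poincare h0
    rw [hd] at h3
    have h4 : d * d ≤ d * (3 * logFactor d) := by
      gcongr
      linarith [one_third_le_logFactor hd0 hd1]
    have h5 : 0 ≤ 9 * C ^ 2 * (d * logFactor d) := by positivity
    rw [profile]
    linarith

end TorusNash

theorem proposition4p2 (p : ℝ≥0∞) (hp : 1 < p) (K : ℝ) (hK : 0 < K)
    (𝓕 : Set (TorusNash.T2 → ℝ))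
    (h𝓕 : ∀ f ∈ 𝓕, (∃ G, TorusNash.MemH1With f G) ∧ ∫ x, f x = 0 ∧
      TorusNash.HasDecomposition p K f) :
    ∃ Φ : ℝ → ℝ,
      ContDiffOn ℝ 1 Φ (Ici 0) ∧
      ConcaveOn ℝ (Ici 0) Φ ∧
      StrictMonoOn Φ (Ici 0) ∧
      BijOn Φ (Ici 0) (Ici 0) ∧
      Φ =o[atTop] (fun x : ℝ => x) ∧
      Φ =O[atTop] (fun x : ℝ => x * |Real.log x| ^ (-(1 / 4) : ℝ)) ∧
      ∀ f ∈ 𝓕, ∀ G : TorusNash.T2 → EuclideanSpace ℝ (Fin 2), TorusNash.MemH1With f G →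
        TorusNash.upsilon Φ (∫ x, f x ^ 2) ≤ ∫ x, ‖G x‖ ^ 2 := by
  obtain ⟨C, hC, hmass⟩ := TorusNash.exists_local_mass_bound hp hK
  have hA : 0 < 120 + 9 * C ^ 2 := by positivity
  refine ⟨TorusNash.profile (120 + 9 * C ^ 2), TorusNash.contDiffOn_profile,
    TorusNash.concaveOn_profile hA, TorusNash.strictMonoOn_profile hA,
    TorusNash.bijOn_profile hA, TorusNash.isLittleO_profile, TorusNash.isBigO_profile, ?_⟩
  intro f hf G hG
  obtain ⟨-, h0, hdec⟩ := h𝓕 f hf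
  obtain ⟨h1, h2⟩ := hmass f (hG.memLp.integrable (by norm_num)) hdec
  have hd : ∫ x, ‖G x‖ ^ 2 = √(∫ x, ‖G x‖ ^ 2) ^ 2 :=
    (Real.sq_sqrt (integral_nonneg fun x => sq_nonneg _)).symm
  rw [hd]
  exact TorusNash.upsilon_profile_le hA (integral_nonneg fun x => sq_nonneg _) (Real.sqrt_nonneg _)
    (hG.integral_sq_le_profile h0 hC h1 h2 (Real.sqrt_nonneg _) hd)
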